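/- For $n\ge 1$ let $\Pi_n$ be the lattice of set partitions of $\{1,\dots,n\}$ ordered by refinement, in which a partition with $b$ blocks has rank $n-b$. For a finite nonempty set $S$ of positive integers let $\Pi_n(S)$ be the subposet of all partitions whose rank lies in $S$. The symmetric group $S_n$ acts on $\Pi_n(S)$. Let $\alpha_S(n)$ be the complex permutation representation of $S_n$ on the maximal chains of $\Pi_n(S)$, and let $\beta_S(n)$ be the complex representation of $S_n$ on the top reduced homology $\tilde H_{|S|-1}(\Pi_n(S);\mathbb C)$ of the order complex of $\Pi_n(S)$. For $k\ge 0$ and $n>k$ let $V(1^k)$ be the irreducible representation of $S_n$ indexed by the hook partition $(n-k,1^k)$ (with $k$ parts equal to $1$ after the first part). Fix a finite nonempty set $S$ of positive integers and an integer $k\ge 0$. Then the multiplicity of $V(1^k)$ in $\alpha_S(n)$ and the multiplicity of $V(1^k)$ in $\beta_S(n)$ are both stable for $n\ge 2\max(S)+k$: there are nonnegative integers $a$ and $b$, depending only on $S$ and $k$, such that for every $n\ge 2\max(S)+k$ these multiplicities are equal to $a$ and $b$ respectively. -/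

import Mathlib

open scoped MonoidAlgebra

noncomputable section

namespace RankStab

/-! ### Multiplicities -/

/-- The multiplicity of a complex irreducible representation `V` in a representation `W`
of a group: the dimension of the space of equivariant maps from `V` to `W`. -/
def multiplicity {G V W : Type*} [Group G] [AddCommGroup V] [Module ℂ V]
    [AddCommGroup W] [Module ℂ W] (ρ : Representation ℂ G V) (σ : Representation ℂ G W) : ℕ :=
  Module.finrank ℂ (Representation.IntertwiningMap ρ σ)

/-! ### Specht modules

A tableau of shape `μ` with entries `0, …, n - 1`, each used once, is a bijection
`T : Fin n ≃ μ.cells`, sending an entry to the cell `(row, column)` where it stands. -/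

section Specht

variable {n : ℕ} {μ : YoungDiagram}

/-- The permutations of the entries which preserve every row of the tableau. -/
def rowGroup (T : Fin n ≃ μ.cells) : Subgroup (Equiv.Perm (Fin n)) where
  carrier := {g | ∀ x, (T (g x)).1.1 = (T x).1.1}
  one_mem' := fun _ => rfl
  mul_mem' := fun {a b} ha hb x => (ha (b x)).trans (hb x)
  inv_mem' := fun {a} ha x => by
    have h := ha (a⁻¹ x)
    rw [show a (a⁻¹ x) = x from a.apply_symm_apply x] at h
    exact h.symm

/-- The permutations of the entries which preserve every column of the tableau. -/
def colGroup (T : Fin n ≃ μ.cells) : Subgroup (Equiv.Perm (Fin n)) where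
  carrier := {g | ∀ x, (T (g x)).1.2 = (T x).1.2}
  one_mem' := fun _ => rfl
  mul_mem' := fun {a b} ha hb x => (ha (b x)).trans (hb x)
  inv_mem' := fun {a} ha x => by
    have h := ha (a⁻¹ x)
    rw [show a (a⁻¹ x) = x from a.apply_symm_apply x] at h
    exact h.symm

open Classical in
/-- The Young symmetrizer: the sum of the row group times the signed sum of the column group,
in the group algebra of `S_n`. -/
def youngSymmetrizer (T : Fin n ≃ μ.cells) : ℂ[Equiv.Perm (Fin n)] :=
  (∑ p : rowGroup T, MonoidAlgebra.single (p : Equiv.Perm (Fin n)) (1 : ℂ)) *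
    ∑ q : colGroup T, MonoidAlgebra.single (q : Equiv.Perm (Fin n))
      (((Equiv.Perm.sign (q : Equiv.Perm (Fin n)) : ℤ) : ℂ))

/-- The left ideal `ℂ[S_n] c` generated by the Young symmetrizer `c` of `T`. -/
def spechtIdeal (T : Fin n ≃ μ.cells) : Submodule ℂ ℂ[Equiv.Perm (Fin n)] :=
  LinearMap.range (LinearMap.mulRight ℂ (youngSymmetrizer T))

/-- The irreducible representation of `S_n` indexed by the partition whose Young diagram is `μ`,
realized as the left ideal generated by the Young symmetrizer of a tableau `T` of shape `μ`, on
which `S_n` acts by left multiplication (up to isomorphism it depends on `μ` only). The one-row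
diagram gives the trivial representation and the one-column diagram the sign representation. -/
def specht (T : Fin n ≃ μ.cells) : Representation ℂ (Equiv.Perm (Fin n)) (spechtIdeal T) :=
  (Representation.leftRegular ℂ (Equiv.Perm (Fin n))).subrepresentation (spechtIdeal T) (by
    rintro g _ ⟨w, rfl⟩
    refine ⟨MonoidAlgebra.single g 1 * w, ?_⟩
    ext x
    rw [LinearMap.mulRight_apply, LinearMap.mulRight_apply, mul_assoc,
      MonoidAlgebra.coeff_single_mul_apply, one_mul, Representation.coeff_ofMulAction, smul_eq_mul])

end Specht

/-! ### Homology of three consecutive terms of a complex -/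

section Homology

variable {k G U V W : Type*} [CommRing k] [Group G] [AddCommGroup U] [Module k U]
  [AddCommGroup V] [Module k V] [AddCommGroup W] [Module k W]

/-- The homology `ker g / im f` at the middle term of `U → V → W`, with maps `f` and `g`. -/
abbrev MiddleHomology (f : U →ₗ[k] V) (g : V →ₗ[k] W) : Type _ :=
  LinearMap.ker g ⧸ (LinearMap.range f).comap (LinearMap.ker g).subtype

/-- The action of `G` on the homology at the middle term, if `G` acts on all three terms and
the two maps are equivariant. -/
def middleHomologyRep {ρ : Representation k G U} {σ : Representation k G V}
    {τ : Representation k G W} (f : Representation.IntertwiningMap ρ σ)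
    (g : Representation.IntertwiningMap σ τ) :
    Representation k G (MiddleHomology f.toLinearMap g.toLinearMap) :=
  (σ.subrepresentation (LinearMap.ker g.toLinearMap) fun a v hv => by
      have hv' : g v = 0 := hv
      change g (σ a v) = 0
      rw [g.isIntertwining, hv', map_zero]).quotient
    ((LinearMap.range f.toLinearMap).comap (LinearMap.ker g.toLinearMap).subtype) <| by
      rintro a ⟨v, hv⟩ ⟨u, hu⟩
      have hu' : f u = v := hu
      refine ⟨ρ a u, ?_⟩
      change f (ρ a u) = σ a v
      rw [f.isIntertwining, hu']

end Homology

/-! ### Chains and reduced homology of a poset -/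

section Poset

variable (k : Type*) [CommRing k] (P : Type*) [PartialOrder P]

/-- The permutation representation of the automorphism group of `P` on the free `k`-module
with basis the maximal chains of `P`. -/
def flagRep : Representation k (P ≃o P) k[Flag P] :=
  Representation.ofMulAction k (P ≃o P) (Flag P)

/-- The module of simplicial chains spanned by the simplices with `m` vertices of the order complex
of `P`, that is, by the chains `x₀ < ⋯ < x_{m-1}` of `P`. For `m = 0` there is exactly one
such simplex, the empty one. -/
abbrev SimplicialChains (m : ℕ) : Type _ := (Fin m ↪o P) →₀ k

variable {P} in
/-- The `i`-th face of a simplex, obtained by omitting its `i`-th vertex. -/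
def face {m : ℕ} (i : Fin (m + 1)) (x : Fin (m + 1) ↪o P) : Fin m ↪o P :=
  (Fin.succAboveOrderEmb i).trans x

/-- The simplicial boundary map
`(x₀ < ⋯ < x_m) ↦ ∑ᵢ (-1)ⁱ (x₀ < ⋯ < x_{i-1} < x_{i+1} < ⋯ < x_m)`; for `m = 0` it is the
augmentation. -/
def boundary (m : ℕ) : SimplicialChains k P (m + 1) →ₗ[k] SimplicialChains k P m :=
  Finsupp.linearCombination k fun x => ∑ i : Fin (m + 1), Finsupp.single (face i x) ((-1) ^ (i : ℕ))

/-- The action of the automorphisms of `P` on simplicial chains, vertex by vertex. -/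
def chainRep (m : ℕ) : Representation k (P ≃o P) (SimplicialChains k P m) where
  toFun e := Finsupp.lmapDomain k k fun x => x.trans e.toOrderEmbedding
  map_one' := by
    refine Finsupp.lhom_ext fun x c => ?_
    simp only [Finsupp.lmapDomain_apply, Finsupp.mapDomain_single]
    rfl
  map_mul' e f := by
    refine Finsupp.lhom_ext fun x c => ?_
    simp only [Module.End.mul_apply, Finsupp.lmapDomain_apply, Finsupp.mapDomain_single]
    rfl

theorem boundary_chainRep (m : ℕ) (e : P ≃o P) (v : SimplicialChains k P (m + 1)) :
    boundary k P m (chainRep k P (m + 1) e v) = chainRep k P m e (boundary k P m v) := by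
  induction v using Finsupp.induction_linear with
  | zero => simp
  | add v w hv hw => simp only [map_add, hv, hw]
  | single x c =>
    simp only [chainRep, boundary, MonoidHom.coe_mk, OneHom.coe_mk, Finsupp.lmapDomain_apply,
      Finsupp.mapDomain_single, Finsupp.linearCombination_single, Finsupp.mapDomain_smul]
    congr 1
    rw [Finsupp.mapDomain_finsetSum]
    simp only [Finsupp.mapDomain_single]
    rfl

/-- The boundary map, as an equivariant map. -/
def boundaryMap (m : ℕ) : Representation.IntertwiningMap (chainRep k P (m + 1)) (chainRep k P m) :=
  (boundary k P m).intertwiningMap_of_isIntertwiningMap _ _ (boundary_chainRep k P m)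

/-- The reduced simplicial homology in dimension `d ≥ 0`, with coefficients in `k`, of the order
complex of `P` (the complex of all chains of `P`): cycles modulo boundaries. -/
abbrev ReducedHomology (d : ℕ) : Type _ :=
  MiddleHomology (boundary k P (d + 1)) (boundary k P d)

/-- The action of the automorphisms of `P` on its reduced homology. -/
def homologyRep (d : ℕ) : Representation k (P ≃o P) (ReducedHomology k P d) :=
  middleHomologyRep (boundaryMap k P (d + 1)) (boundaryMap k P d)

end Poset

/-! ### The partition lattice

A partition of `{0, …, n - 1}` is an equivalence relation on `Fin n`, and Mathlib's order on
`Setoid (Fin n)` is refinement: `π ≤ σ` if each block of `π` is contained in a block of `σ`. -/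

section PartitionLattice

variable {n : ℕ}

/-- The rank of a partition in the partition lattice: `n` minus the number of blocks. -/
def rank (π : Setoid (Fin n)) : ℕ := n - Nat.card (Quotient π)

/-- The image of a partition under a permutation `g`: `x` and `y` lie in the same block of the
image if and only if `g⁻¹ x` and `g⁻¹ y` lie in the same block of the given partition. -/
def permPartition (g : Equiv.Perm (Fin n)) (π : Setoid (Fin n)) : Setoid (Fin n) :=
  Setoid.comap (⇑g⁻¹) π

theorem rank_permPartition (g : Equiv.Perm (Fin n)) (π : Setoid (Fin n)) :
    rank (permPartition g π) = rank π := by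
  have h : Nat.card (Quotient (permPartition g π)) = Nat.card (Quotient π) :=
    Nat.card_congr (Quotient.congr g⁻¹ fun _ _ => Iff.rfl)
  simp only [rank, h]

/-- The rank-selected subposet `Π_n(S)` of the partition lattice: the partitions with rank
in `S`, ordered by refinement. -/
abbrev RankSelected (n : ℕ) (S : Finset ℕ) : Type := {π : Setoid (Fin n) // rank π ∈ S}

/-- The action of the symmetric group on `Π_n(S)` by poset automorphisms. -/
def permAut (n : ℕ) (S : Finset ℕ) :
    Equiv.Perm (Fin n) →* (RankSelected n S ≃o RankSelected n S) where
  toFun g :=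
    { toFun := fun π => ⟨permPartition g π.1, by rw [rank_permPartition]; exact π.2⟩
      invFun := fun π => ⟨permPartition g⁻¹ π.1, by rw [rank_permPartition]; exact π.2⟩
      left_inv := fun π => Subtype.ext <| Setoid.ext fun x y => by
        change π.1 (g⁻¹ (g x)) (g⁻¹ (g y)) ↔ π.1 x y
        simp only [show ∀ z, g⁻¹ (g z) = z from g.symm_apply_apply]
      right_inv := fun π => Subtype.ext <| Setoid.ext fun x y => by
        change π.1 (g (g⁻¹ x)) (g (g⁻¹ y)) ↔ π.1 x y
        simp only [show ∀ z, g (g⁻¹ z) = z from g.apply_symm_apply]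
      map_rel_iff' := by
        intro π σ
        refine ⟨fun h x y hxy => ?_, fun h x y hxy => h hxy⟩
        have h' : π.1 (g⁻¹ (g x)) (g⁻¹ (g y)) → σ.1 (g⁻¹ (g x)) (g⁻¹ (g y)) := @h (g x) (g y)
        rw [show ∀ z, g⁻¹ (g z) = z from g.symm_apply_apply] at h'
        rw [show ∀ z, g⁻¹ (g z) = z from g.symm_apply_apply] at h'
        exact h' hxy }
  map_one' := rfl
  map_mul' _ _ := rfl

/-- `α_S(n)`: the permutation representation of `S_n` on the maximal chains of `Π_n(S)`. -/
def alpha (S : Finset ℕ) (n : ℕ) :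
    Representation ℂ (Equiv.Perm (Fin n)) ℂ[Flag (RankSelected n S)] :=
  (flagRep ℂ (RankSelected n S)).comp (permAut n S)

/-- `β_S(n)`, for a nonempty set `S` of ranks: the representation of `S_n` on the top reduced
homology with complex coefficients, in dimension `|S| - 1`, of the order complex of `Π_n(S)`. -/
def beta (S : Finset ℕ) (n : ℕ) :
    Representation ℂ (Equiv.Perm (Fin n)) (ReducedHomology ℂ (RankSelected n S) (S.card - 1)) :=
  (homologyRep ℂ (RankSelected n S) (S.card - 1)).comp (permAut n S)

end PartitionLattice

end RankStab

end

/-! By Maschke, the left ideal generated by an element `c` of `ℂ[S_n]` satisfies `Hom(ℂ[S_n]c, W) ≅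
cW`, so the multiplicity of a Specht module in `W` is the rank of the Young symmetrizer on `W`
(`multiplicity_specht`). Once `n > max S`, the maximal chains of `Π_n(S)` are the chains with `|S|`
members, and no chain is longer. So α is the top simplicial chain module and β is the kernel of the
boundary `∂` on it. Since taking images under `c` is exact, the multiplicity in β is the rank of `c`
minus the rank of `c ∘ ∂`. Both claims reduce to the stability in `n` of the rank of `c ∘ Φ`, for
`Φ` the identity or `∂` (`exists_hookRank_eq`).

For a hook, `c` is the sum over the row group times the signed sum over the symmetric group of the
first column `C`, where `|C| = k + 1`. The row sum has the same kernel as the projection to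
row-group orbits, so it may be replaced by that projection. Pass from `n` to `n + 1` by adding an
isolated point `z` outside the column. This is injective on orbits of chains, because two isolated
points can be swapped freely (`hookRank_succ`).

It also reaches the whole image. A partition of rank at most `M = max S` on `n + 1 ≥ 2M + k + 1`
points has at least `k + 1` isolated points. If one of them lies outside `C`, a row transposition
commuting with the column group moves it to `z`. If all lie in `C` and `k ≥ 1`, a transposition of
two of them fixes the chain, and the signed column sum kills it. If `k = 0` the column group is
trivial and any isolated point can be moved to `z` (`exists_swap_of_isChainIsolated`,
`finrank_range_comparison`). -/

noncomputable section

namespace RankStab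

/-! ### Multiplicities of left ideals of a group algebra -/

section LeftIdeal

variable {G : Type*} [Group G]

/-- The group algebra of a finite group is von Neumann regular. -/
theorem exists_mul_mul_self [Finite G] (c : ℂ[G]) : ∃ u : ℂ[G], c * u * c = c := by
  -- With `e = u * c` idempotent and `c = w * e`, one gets `c * u * c = c * e = w * e * e = c`.
  obtain ⟨e, he, hI⟩ := IsSemisimpleRing.ideal_eq_span_idempotent (Ideal.span {c})
  obtain ⟨u, hu⟩ := Ideal.mem_span_singleton'.1 (hI ▸ Ideal.mem_span_singleton_self e :
    e ∈ Ideal.span {c})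
  obtain ⟨w, hw⟩ := Ideal.mem_span_singleton'.1 (hI ▸ Ideal.mem_span_singleton_self c :
    c ∈ Ideal.span {e})
  refine ⟨u, ?_⟩
  rw [mul_assoc, hu, ← hw, mul_assoc, he.eq]

variable {V W : Type*} [AddCommGroup V] [Module ℂ V] [AddCommGroup W] [Module ℂ W]

theorem asAlgebraHom_comm {ρ : Representation ℂ G V} {σ : Representation ℂ G W} (f : V →ₗ[ℂ] W)
    (hf : ∀ g v, f (ρ g v) = σ g (f v)) (a : ℂ[G]) (v : V) :
    f (ρ.asAlgebraHom a v) = σ.asAlgebraHom a (f v) := by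
  induction a using MonoidAlgebra.induction_on with
  | of g => simp [hf]
  | add x y hx hy => simp [hx, hy]
  | smul r x hx => simp [hx]

theorem leftRegular_asAlgebraHom (a x : ℂ[G]) :
    (Representation.leftRegular ℂ G).asAlgebraHom a x = a * x :=
  Representation.asAlgebraHom_ofMulAction_smul_eq_mul a x

/-- Equivariant maps out of the left ideal generated by `c` correspond to the elements of the
image of `c`. -/
theorem finrank_intertwiningMap_leftIdeal [Finite G] (c : ℂ[G])
    (h : ∀ g, LinearMap.range (LinearMap.mulRight ℂ c) ≤
      (LinearMap.range (LinearMap.mulRight ℂ c)).comap (Representation.leftRegular ℂ G g))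
    (σ : Representation ℂ G W) :
    Module.finrank ℂ (Representation.IntertwiningMap
      ((Representation.leftRegular ℂ G).subrepresentation _ h) σ) =
      Module.finrank ℂ (LinearMap.range (σ.asAlgebraHom c)) := by
  obtain ⟨u, hu⟩ := exists_mul_mul_self c
  set I := LinearMap.range (LinearMap.mulRight ℂ c)
  set ρ := (Representation.leftRegular ℂ G).subrepresentation I h
  have hval (a : ℂ[G]) (x : I) : ((ρ.asAlgebraHom a x : I) : ℂ[G]) = a * x := by
    rw [← leftRegular_asAlgebraHom]
    exact asAlgebraHom_comm (σ := Representation.leftRegular ℂ G) I.subtype (fun _ _ => rfl) a x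
  let c' : I := ⟨c, 1, by simp⟩
  -- An equivariant map is determined by its value at the generator `c`; the rest identifies the
  -- possible values.
  let ev : Representation.IntertwiningMap ρ σ →ₗ[ℂ] W :=
    { toFun := fun f => f c'
      map_add' := fun _ _ => rfl
      map_smul' := fun _ _ => rfl }
  have hgen (f : Representation.IntertwiningMap ρ σ) (a : ℂ[G]) (x y : I)
      (hxy : (y : ℂ[G]) = a * x) : f y = σ.asAlgebraHom a (f x) := by
    refine Eq.trans ?_ (asAlgebraHom_comm (ρ := ρ) f.toLinearMap f.isIntertwining a x)
    exact congrArg f (Subtype.ext (hxy.trans (hval a x).symm))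
  have hinj : Function.Injective ev := fun f f' hff' => by
    refine Representation.IntertwiningMap.ext (LinearMap.ext fun y => ?_)
    obtain ⟨a, ha⟩ := y.2
    have ha' : (y : ℂ[G]) = a * (c' : ℂ[G]) := ha.symm
    exact (hgen f a c' y ha').trans ((congrArg _ hff').trans (hgen f' a c' y ha').symm)
  have hrange : LinearMap.range ev = LinearMap.range (σ.asAlgebraHom c) := by
    ext w
    constructor
    · rintro ⟨f, rfl⟩
      refine ⟨σ.asAlgebraHom u (f c'), ?_⟩
      rw [← Module.End.mul_apply, ← map_mul]
      exact (hgen f (c * u) c' c' hu.symm).symm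
    · rintro ⟨w, rfl⟩
      -- The map `x ↦ x u c w` takes `c` to `c u c w = c w`.
      let F : I →ₗ[ℂ] W :=
        (LinearMap.applyₗ (σ.asAlgebraHom (u * c) w)).comp
          (σ.asAlgebraHom.toLinearMap.comp I.subtype)
      have hF (x : I) : F x = σ.asAlgebraHom (x : ℂ[G]) (σ.asAlgebraHom (u * c) w) := rfl
      refine ⟨F.intertwiningMap_of_isIntertwiningMap ρ σ fun g x => ?_, ?_⟩
      · have h1 := hval (MonoidAlgebra.single g 1) x
        rw [Representation.asAlgebraHom_single_one] at h1
        rw [hF, hF, h1, map_mul, Representation.asAlgebraHom_single_one]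
        rfl
      · change F c' = _
        rw [hF, ← Module.End.mul_apply, ← map_mul, ← mul_assoc]
        exact congrArg (fun a => σ.asAlgebraHom a w) hu
  rw [← hrange, LinearMap.finrank_range_of_inj hinj]

theorem multiplicity_congr {U : Type*} [AddCommGroup U] [Module ℂ U] (ρ : Representation ℂ G U)
    {σ : Representation ℂ G V} {τ : Representation ℂ G W} (e : V ≃ₗ[ℂ] W)
    (he : ∀ g v, e (σ g v) = τ g (e v)) : multiplicity ρ σ = multiplicity ρ τ := by
  have he' (g : G) (w : W) : e.symm (τ g w) = σ g (e.symm w) := by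
    rw [LinearEquiv.symm_apply_eq, he, LinearEquiv.apply_symm_apply]
  refine LinearEquiv.finrank_eq (R := ℂ)
    { toFun := fun f => ((e : V →ₗ[ℂ] W) ∘ₗ f.toLinearMap).intertwiningMap_of_isIntertwiningMap ρ τ
        fun g u => by
          change e (f (ρ g u)) = τ g (e (f u))
          rw [f.isIntertwining, he]
      invFun := fun f =>
        ((e.symm : W →ₗ[ℂ] V) ∘ₗ f.toLinearMap).intertwiningMap_of_isIntertwiningMap ρ σ
          fun g u => by
            change e.symm (f (ρ g u)) = σ g (e.symm (f u))
            rw [f.isIntertwining, he']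
      map_add' := fun f f' => Representation.IntertwiningMap.ext <| LinearMap.ext fun u =>
        map_add e (f u) (f' u)
      map_smul' := fun r f => Representation.IntertwiningMap.ext <| LinearMap.ext fun u =>
        map_smul e r (f u)
      left_inv := fun f => Representation.IntertwiningMap.ext <| LinearMap.ext fun u =>
        e.symm_apply_apply (f u)
      right_inv := fun f => Representation.IntertwiningMap.ext <| LinearMap.ext fun u =>
        e.apply_symm_apply (f u) }

/-- The rank of `c` on the kernel of an equivariant map, as a difference of two ranks. -/
theorem finrank_range_asAlgebraHom_ker [Finite G] [FiniteDimensional ℂ V]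
    {σ : Representation ℂ G V} {τ : Representation ℂ G W} (f : V →ₗ[ℂ] W)
    (hf : ∀ g v, f (σ g v) = τ g (f v))
    (h : ∀ g, LinearMap.ker f ≤ (LinearMap.ker f).comap (σ g)) (c : ℂ[G]) :
    Module.finrank ℂ (LinearMap.range ((σ.subrepresentation (LinearMap.ker f) h).asAlgebraHom c)) =
      Module.finrank ℂ (LinearMap.range (σ.asAlgebraHom c)) -
        Module.finrank ℂ (LinearMap.range (τ.asAlgebraHom c ∘ₗ f)) := by
  obtain ⟨u, hu⟩ := exists_mul_mul_self c
  set K := LinearMap.ker f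
  set κ := σ.subrepresentation K h
  have hval (a : ℂ[G]) (x : K) : ((κ.asAlgebraHom a x : K) : V) = σ.asAlgebraHom a x :=
    asAlgebraHom_comm (σ := σ) K.subtype (fun _ _ => rfl) a x
  set A := LinearMap.range (σ.asAlgebraHom c)
  have hfA : LinearMap.range (τ.asAlgebraHom c ∘ₗ f) = LinearMap.range (f.domRestrict A) := by
    ext w
    constructor
    · rintro ⟨v, rfl⟩
      exact ⟨⟨_, v, rfl⟩, asAlgebraHom_comm f hf c v⟩
    · rintro ⟨⟨_, v, rfl⟩, rfl⟩
      exact ⟨v, (asAlgebraHom_comm f hf c v).symm⟩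
  -- This is `c (ker f) = ker f ∩ c V`: if `c w` is in `ker f`, then so is `u c w`, and `c` sends it
  -- to `c u c w = c w`. Rank-nullity for `f` on `c V` then finishes.
  have hker : (LinearMap.range (κ.asAlgebraHom c)).map K.subtype =
      (LinearMap.ker (f.domRestrict A)).map A.subtype := by
    ext v
    constructor
    · rintro ⟨_, ⟨x, rfl⟩, rfl⟩
      refine ⟨⟨σ.asAlgebraHom c x, x, rfl⟩, ?_, (hval c x).symm⟩
      have := (κ.asAlgebraHom c x).2
      rw [hval] at this
      exact this
    · rintro ⟨⟨_, w, rfl⟩, hv, rfl⟩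
      have hv' : f (σ.asAlgebraHom c w) = 0 := hv
      refine ⟨_, ⟨⟨σ.asAlgebraHom u (σ.asAlgebraHom c w), ?_⟩, rfl⟩, ?_⟩
      · change f _ = 0
        rw [asAlgebraHom_comm f hf, hv', map_zero]
      · change ((κ.asAlgebraHom c _ : K) : V) = σ.asAlgebraHom c w
        rw [hval]
        change σ.asAlgebraHom c (σ.asAlgebraHom u (σ.asAlgebraHom c w)) = _
        rw [← Module.End.mul_apply, ← Module.End.mul_apply, ← map_mul, ← map_mul, hu]
  have h1 := LinearMap.finrank_range_add_finrank_ker (f.domRestrict A)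
  have h2 := congrArg (fun p : Submodule ℂ V => Module.finrank ℂ p) hker
  simp only [Submodule.finrank_map_subtype_eq] at h2
  rw [hfA, h2]
  omega

end LeftIdeal

theorem multiplicity_specht {n : ℕ} {μ : YoungDiagram} (T : Fin n ≃ μ.cells) {W : Type*}
    [AddCommGroup W] [Module ℂ W] (σ : Representation ℂ (Equiv.Perm (Fin n)) W) :
    multiplicity (specht T) σ =
      Module.finrank ℂ (LinearMap.range (σ.asAlgebraHom (youngSymmetrizer T))) :=
  finrank_intertwiningMap_leftIdeal _ _ σ

/-! ### Row and column groups of a hook -/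

section Hook

variable {n k : ℕ} {μ : YoungDiagram}

theorem mem_hook_iff (hk : k < n) (hμ : μ.rowLens = (n - k) :: List.replicate k 1) (i j : ℕ) :
    (i, j) ∈ μ ↔ (i = 0 ∧ j < n - k) ∨ (i ≤ k ∧ j = 0) := by
  have hlen : μ.colLen 0 = k + 1 := by rw [← YoungDiagram.length_rowLens, hμ]; simp
  rw [YoungDiagram.mem_iff_lt_rowLen]
  by_cases hi : i ≤ k
  · have h : i < μ.rowLens.length := by rw [YoungDiagram.length_rowLens]; omega
    rw [← YoungDiagram.get_rowLens (h := h)]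
    simp only [hμ]
    cases i with
    | zero => simp; omega
    | succ i => simp; omega
  · have : ¬ (i, 0) ∈ μ := by rw [YoungDiagram.mem_iff_lt_colLen]; omega
    rw [YoungDiagram.mem_iff_lt_rowLen] at this
    omega

/-- The entries of the first column of a tableau. -/
def firstColumn (T : Fin n ≃ μ.cells) : Finset (Fin n) := {x | (T x).1.2 = 0}

theorem card_firstColumn (T : Fin n ≃ μ.cells) : (firstColumn T).card = μ.colLen 0 := by
  rw [YoungDiagram.colLen_eq_card]
  refine Finset.card_bij (fun x _ => (T x).1) (fun x hx => ?_) (fun x _ y _ h => ?_) fun c hc => ?_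
  · rw [YoungDiagram.mem_col_iff]
    exact ⟨(T x).2, by simpa [firstColumn] using hx⟩
  · exact T.injective (Subtype.ext h)
  · rw [YoungDiagram.mem_col_iff] at hc
    exact ⟨T.symm ⟨c, hc.1⟩, by simp [firstColumn, hc.2], by simp⟩

/-- A cell of a hook below the corner is alone in its row, and a cell outside the first column is
alone in its column. Hence both groups are pointwise stabilizers, and the tableau matters only
through its first column and corner entry. -/
theorem exists_hook_groups (hk : k < n) (hμ : μ.rowLens = (n - k) :: List.replicate k 1)
    (T : Fin n ≃ μ.cells) : ∃ C : Finset (Fin n), ∃ c ∈ C, C.card = k + 1 ∧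
      rowGroup T = fixingSubgroup (Equiv.Perm (Fin n)) ((C : Set (Fin n)) \ {c}) ∧
      colGroup T = fixingSubgroup (Equiv.Perm (Fin n)) (C : Set (Fin n))ᶜ := by
  have hmem (x : Fin n) := (mem_hook_iff hk hμ (T x).1.1 (T x).1.2).1 (T x).2
  have h0 : (0, 0) ∈ μ := (mem_hook_iff hk hμ 0 0).2 (by omega)
  have hC (x : Fin n) : x ∈ firstColumn T ↔ (T x).1.2 = 0 := by simp [firstColumn]
  have heq (x y : Fin n) (h1 : (T x).1.1 = (T y).1.1) (h2 : (T x).1.2 = (T y).1.2) : x = y :=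
    T.injective (Subtype.ext (Prod.ext h1 h2))
  set c := T.symm ⟨(0, 0), h0⟩
  have hc : (T c).1 = (0, 0) := by simp [c]
  have hne (x : Fin n) : x ≠ c ∧ (T x).1.2 = 0 ↔ (T x).1.1 ≠ 0 := by
    constructor
    · rintro ⟨h1, h2⟩ h3
      exact h1 (heq _ _ (by rw [h3, hc]) (by rw [h2, hc]))
    · intro h
      refine ⟨?_, by have := hmem x; omega⟩
      rintro rfl
      exact h (by rw [hc])
  refine ⟨firstColumn T, c, (hC _).2 (by rw [hc]), ?_, ?_, ?_⟩
  · rw [card_firstColumn, ← YoungDiagram.length_rowLens, hμ]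
    simp
  · ext g
    rw [mem_fixingSubgroup_iff]
    change (∀ x, (T (g x)).1.1 = (T x).1.1) ↔ ∀ x ∈ (firstColumn T : Set (Fin n)) \ {c}, g x = x
    simp only [Set.mem_sdiff, Finset.mem_coe, hC, Set.mem_singleton_iff]
    constructor
    · intro h x hx
      have hx' := (hne x).1 ⟨hx.2, hx.1⟩
      have := hmem (g x)
      have := h x
      exact heq _ _ this (by omega)
    · intro h x
      by_cases hx : (T x).1.1 = 0
      · by_contra hgx
        have h1 := (hne (g x)).2 (by omega)
        have h2 := g.injective (h (g x) ⟨h1.2, h1.1⟩)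
        exact hgx (by rw [h2])
      · have h1 := (hne x).2 hx
        rw [h x ⟨h1.2, h1.1⟩]
  · ext g
    rw [mem_fixingSubgroup_iff]
    change (∀ x, (T (g x)).1.2 = (T x).1.2) ↔ ∀ x ∈ (firstColumn T : Set (Fin n))ᶜ, g x = x
    simp only [Set.mem_compl_iff, Finset.mem_coe, hC]
    constructor
    · intro h x hx
      have := hmem x
      have := hmem (g x)
      have := h x
      exact heq _ _ (by omega) this
    · intro h x
      by_cases hx : (T x).1.2 = 0
      · by_contra hgx
        have h2 := g.injective (h (g x) (by omega))
        exact hgx (by rw [h2])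
      · rw [h x hx]

end Hook

/-! ### Ranks of partitions -/

section Rank

variable {n : ℕ}

theorem card_quotient_le (π : Setoid (Fin n)) : Nat.card (Quotient π) ≤ n := by
  simpa using Nat.card_le_card_of_surjective (Quotient.mk π) Quotient.mk_surjective

theorem rank_mono {π σ : Setoid (Fin n)} (h : π ≤ σ) : rank π ≤ rank σ :=
  Nat.sub_le_sub_left (Nat.card_le_card_of_surjective
    (Quotient.lift (Quotient.mk σ) fun _ _ hab => Quotient.sound (h hab))
    (Quotient.ind fun a => ⟨Quotient.mk π a, rfl⟩ : Function.Surjective _)) n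

/-- Equal ranks make the surjection between the finite sets of blocks bijective, which forces the
partitions to agree. -/
theorem rank_strictMono : StrictMono (rank : Setoid (Fin n) → ℕ) := by
  intro π σ h
  refine lt_of_le_of_ne (rank_mono h.le) fun heq => h.not_ge fun {x y} hxy => ?_
  have hcard : Nat.card (Quotient π) = Nat.card (Quotient σ) := by
    have h1 := card_quotient_le π
    have h2 := card_quotient_le σ
    unfold rank at heq
    omega
  have hs : Function.Surjective (Quotient.lift (Quotient.mk σ)
      fun a b (hab : π a b) => Quotient.sound (h.le hab)) :=
    Quotient.ind fun a => ⟨Quotient.mk π a, rfl⟩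
  have hb := (Nat.bijective_iff_surjective_and_card _).2 ⟨hs, hcard⟩
  exact Quotient.exact (hb.1 (Quotient.sound hxy : Quotient.mk σ x = Quotient.mk σ y))

/-- Merging two blocks. -/
theorem exists_rank_succ {π σ : Setoid (Fin n)} (h : π < σ) :
    ∃ τ, π ≤ τ ∧ τ ≤ σ ∧ rank τ = rank π + 1 := by
  classical
  obtain ⟨x, y, hσ, hπ⟩ : ∃ x y, σ x y ∧ ¬ π x y := by
    by_contra! hc
    exact h.not_ge fun {x y} => hc x y
  -- Relabel the block of `y` as the block of `x`; the range then misses exactly one block.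
  let f : Fin n → Quotient π := fun u =>
    if Quotient.mk π u = Quotient.mk π y then Quotient.mk π x else Quotient.mk π u
  have hrange : Set.range f = {Quotient.mk π y}ᶜ := by
    ext q
    constructor
    · rintro ⟨u, rfl⟩ (hu : f u = _)
      simp only [f] at hu
      split_ifs at hu with h1
      · exact hπ (Quotient.exact hu)
      · exact h1 hu
    · intro hq
      obtain ⟨u, rfl⟩ := Quotient.exists_rep q
      exact ⟨u, if_neg hq⟩
  refine ⟨Setoid.ker f, ?_, ?_, ?_⟩
  · intro u v huv
    change f u = f v
    simp only [f, (Quotient.sound huv : Quotient.mk π u = Quotient.mk π v)]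
  · have key (u : Fin n) : ∃ w, f u = Quotient.mk π w ∧ σ u w := by
      by_cases hu : Quotient.mk π u = Quotient.mk π y
      · exact ⟨x, if_pos hu, σ.trans (h.le (Quotient.exact hu)) (σ.symm hσ)⟩
      · exact ⟨u, if_neg hu, σ.refl u⟩
    intro u v huv
    obtain ⟨a, ha, hua⟩ := key u
    obtain ⟨b, hb, hvb⟩ := key v
    have hab : π a b := Quotient.exact (ha.symm.trans ((huv : f u = f v).trans hb))
    exact σ.trans hua (σ.trans (h.le hab) (σ.symm hvb))
  · have h1 : Nat.card (Quotient (Setoid.ker f)) = Nat.card (Quotient π) - 1 := by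
      rw [Nat.card_congr (Setoid.quotientKerEquivRange f), Nat.card_coe_set_eq, hrange,
        Set.ncard_compl, Set.ncard_singleton]
    have h2 := card_quotient_le π
    have : Nonempty (Quotient π) := ⟨Quotient.mk π x⟩
    have h3 : 0 < Nat.card (Quotient π) := Nat.card_pos
    unfold rank
    omega

theorem exists_rank_eq {π σ : Setoid (Fin n)} (h : π ≤ σ) {s : ℕ} (hs : rank π ≤ s)
    (hs' : s ≤ rank σ) : ∃ τ, π ≤ τ ∧ τ ≤ σ ∧ rank τ = s := by
  induction s, hs using Nat.le_induction with
  | base => exact ⟨π, le_rfl, h, rfl⟩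
  | succ s _ ih =>
    obtain ⟨τ, h1, h2, h3⟩ := ih (by omega)
    obtain ⟨τ', h4, h5, h6⟩ := exists_rank_succ (lt_of_le_of_ne h2 (by rintro rfl; omega))
    exact ⟨τ', h1.trans h4, h5, by omega⟩

theorem rank_bot : rank (⊥ : Setoid (Fin n)) = 0 := by
  have : Nat.card (Quotient (⊥ : Setoid (Fin n))) = n := by
    rw [Nat.card_congr (Setoid.quotientBotEquiv (α := Fin n))]
    simp
  rw [rank, this, Nat.sub_self]

theorem rank_top : n - 1 ≤ rank (⊤ : Setoid (Fin n)) := by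
  have : Nat.card (Quotient (⊤ : Setoid (Fin n))) ≤ 1 :=
    Finite.card_le_one_iff_subsingleton.2
      ⟨fun a b => Quotient.inductionOn₂ a b fun _ _ => Quotient.sound trivial⟩
  exact Nat.sub_le_sub_left this n

end Rank

/-! ### Maximal chains of a graded poset -/

section Flags

variable {P : Type*} [PartialOrder P] {S : Finset ℕ} {r : P → ℕ} {m : ℕ}

/-- The `|S|` members have distinct ranks in `S`, so every rank is used, and a further comparable
element would share its rank with a member. -/
theorem isMaxChain_range (hm : S.card = m) (hr : StrictMono r) (hS : ∀ p, r p ∈ S)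
    (x : Fin m ↪o P) :
    IsMaxChain (· ≤ ·) (Set.range x) := by
  refine ⟨?_, fun t ht hle => hle.antisymm fun p hp => ?_⟩
  · rintro _ ⟨i, rfl⟩ _ ⟨j, rfl⟩ _
    simpa using le_total i j
  · have hinj : Function.Injective fun i => (⟨r (x i), hS _⟩ : S) := fun i j hij =>
      (hr.comp x.strictMono).injective (congrArg Subtype.val hij)
    have hbij := (Nat.bijective_iff_injective_and_card _).2 ⟨hinj, by simp [hm]⟩
    obtain ⟨i, hi⟩ := hbij.2 ⟨r p, hS p⟩
    have hi' : r (x i) = r p := congrArg Subtype.val hi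
    refine ⟨i, ?_⟩
    rcases ht.total (hle ⟨i, rfl⟩) hp with h | h
    · exact h.eq_of_not_lt fun hlt => (hr hlt).ne hi'
    · exact (h.eq_of_not_lt fun hlt => (hr hlt).ne hi'.symm).symm

/-- If every maximal chain meets every rank, the maximal chains are the chains with `|S|`
elements. -/
def chainEquivFlag (hm : S.card = m) (hr : StrictMono r) (hS : ∀ p, r p ∈ S)
    (hF : ∀ F : Flag P, ∀ s ∈ S, ∃ p ∈ F, r p = s) : (Fin m ↪o P) ≃ Flag P :=
  Equiv.ofBijective (fun x => Flag.ofIsMaxChain _ (isMaxChain_range hm hr hS x)) <| by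
    constructor
    · intro x y hxy
      exact OrderEmbedding.range_inj.1 (congrArg (fun F : Flag P => (F : Set P)) hxy)
    · intro F
      classical
      -- Rank is a bijection from the flag to `S`, so the flag can be enumerated in order by `Fin
      -- m`.
      let g : F → S := fun p => ⟨r p, hS p⟩
      have hg : Function.Bijective g := by
        constructor
        · intro p q hpq
          have h1 : r p = r q := congrArg Subtype.val hpq
          rcases le_total p q with h | h
          · exact h.eq_of_not_lt fun hlt => (hr hlt).ne h1
          · exact (h.eq_of_not_lt fun hlt => (hr hlt).ne h1.symm).symm
        · rintro ⟨s, hs⟩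
          obtain ⟨p, hp, rfl⟩ := hF F s hs
          exact ⟨⟨p, hp⟩, rfl⟩
      let : Fintype F := Fintype.ofEquiv S (Equiv.ofBijective g hg).symm
      have hcard : Fintype.card F = m := by
        rw [Fintype.card_of_bijective hg, Fintype.card_coe, hm]
      let e := Fintype.orderIsoFinOfCardEq F hcard
      refine ⟨e.toOrderEmbedding.trans (OrderEmbedding.subtype _), Flag.ext ?_⟩
      change Set.range (fun i => ((e i : F) : P)) = F
      rw [← Function.comp_def, EquivLike.range_comp]
      exact Subtype.range_coe

theorem chainEquivFlag_trans (hm : S.card = m) (hr : StrictMono r) (hS : ∀ p, r p ∈ S)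
    (hF : ∀ F : Flag P, ∀ s ∈ S, ∃ p ∈ F, r p = s) (x : Fin m ↪o P) (e : P ≃o P) :
    chainEquivFlag hm hr hS hF (x.trans e.toOrderEmbedding) = e • chainEquivFlag hm hr hS hF x := by
  refine Flag.ext ?_
  rw [Flag.coe_smul]
  change Set.range (e ∘ x) = e '' Set.range x
  exact Set.range_comp _ _

end Flags

instance {α : Type*} [Finite α] : Finite (Setoid α) :=
  Finite.of_injective (fun π : Setoid α => (π : α → α → Prop)) fun _ _ h =>
    Setoid.ext fun a b => iff_of_eq (congrFun (congrFun h a) b)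

/-! ### Maximal chains of the rank-selected partition poset -/

section RankSelected

variable {n : ℕ} {S : Finset ℕ}

theorem rankSelected_strictMono : StrictMono fun p : RankSelected n S => rank p.1 :=
  fun _ _ h => rank_strictMono h

/-- Adjoin `⊥` and `⊤` to the flag, and interpolate a partition of rank `s` between the largest
member of rank at most `s` and the smallest of rank at least `s`. It is comparable to the whole
flag, so maximality puts it there. The bound on `s` is what lets `⊤` serve as an upper end. -/
theorem exists_mem_flag (F : Flag (RankSelected n S)) {s : ℕ} (hs : s ∈ S) (hn : s ≤ n - 1) :
    ∃ p ∈ F, rank p.1 = s := by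
  classical
  by_contra! hc
  have hchain : IsChain (· ≤ ·) ((↑) '' (F : Set (RankSelected n S)) : Set (Setoid (Fin n))) := by
    rintro _ ⟨p, hp, rfl⟩ _ ⟨q, hq, rfl⟩ _
    exact F.chain_le.total hp hq
  have hext (A : Set (Setoid (Fin n))) (hA : IsChain (· ≤ ·) A) (a : Setoid (Fin n))
      (ha : a ∈ A) : ∃ m ∈ A, ∀ b ∈ A, b ≤ m := by
    obtain ⟨m, hm⟩ := (Set.toFinite A).exists_maximal ⟨a, ha⟩
    refine ⟨m, hm.1, fun b hb => ?_⟩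
    rcases hA.total hb hm.1 with h | h
    · exact h
    · exact hm.2 hb h
  have hext' (A : Set (Setoid (Fin n))) (hA : IsChain (· ≤ ·) A) (a : Setoid (Fin n))
      (ha : a ∈ A) : ∃ m ∈ A, ∀ b ∈ A, m ≤ b := by
    obtain ⟨m, hm⟩ := (Set.toFinite A).exists_minimal ⟨a, ha⟩
    refine ⟨m, hm.1, fun b hb => ?_⟩
    rcases hA.total hm.1 hb with h | h
    · exact h
    · exact hm.2 hb h
  have hfull : IsChain (· ≤ ·) (insert ⊤ (insert ⊥
      ((↑) '' (F : Set (RankSelected n S)) : Set (Setoid (Fin n))))) :=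
    (hchain.insert fun b _ _ => Or.inl bot_le).insert fun b _ _ => Or.inr le_top
  obtain ⟨lo, ⟨hlo, hlos⟩, hlomax⟩ := hext {a | a ∈ insert ⊤ (insert ⊥
    ((↑) '' (F : Set (RankSelected n S)) : Set (Setoid (Fin n)))) ∧ rank a ≤ s}
    (hfull.mono fun _ h => h.1) ⊥ ⟨by simp, by rw [rank_bot]; omega⟩
  obtain ⟨hi, ⟨hhi, hhis⟩, hhimin⟩ := hext' {a | a ∈ insert ⊤ (insert ⊥
    ((↑) '' (F : Set (RankSelected n S)) : Set (Setoid (Fin n)))) ∧ s ≤ rank a}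
    (hfull.mono fun _ h => h.1) ⊤ ⟨by simp, hn.trans rank_top⟩
  have hle : lo ≤ hi := by
    rcases hfull.total hlo hhi with h | h
    · exact h
    · have h1 := rank_mono h
      exact (h.eq_of_not_lt fun hlt => by have := rank_strictMono hlt; omega).ge
  obtain ⟨τ, h1, h2, h3⟩ := exists_rank_eq hle hlos hhis
  let t : RankSelected n S := ⟨τ, h3 ▸ hs⟩
  have ht : IsChain (· ≤ ·) (insert t (F : Set (RankSelected n S))) := by
    refine F.chain_le.insert fun q hq _ => ?_
    have hmem : q.1 ∈ insert ⊤ (insert ⊥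
        ((↑) '' (F : Set (RankSelected n S)) : Set (Setoid (Fin n)))) :=
      Or.inr (Or.inr ⟨q, hq, rfl⟩)
    rcases le_total (rank q.1) s with h | h
    · exact Or.inr ((hlomax _ ⟨hmem, h⟩).trans h1)
    · exact Or.inl (h2.trans (hhimin _ ⟨hmem, h⟩))
  have := F.max_chain' ht (Set.subset_insert _ _)
  exact hc t (this.symm ▸ Set.mem_insert t (F : Set (RankSelected n S)) : t ∈ F.carrier) h3

end RankSelected

/-! ### Sums over subgroups, and ranks modulo the row group -/

section GroupSums

variable {G : Type*} [Group G]

open Classical in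
/-- The sum of the elements of a subgroup. -/
def subgroupSum [Fintype G] (H : Subgroup G) : ℂ[G] := ∑ p : H, MonoidAlgebra.single (p : G) 1

open Classical in
/-- The sum of the elements of a subgroup, weighted by a character. -/
def charSum [Fintype G] (χ : G →* ℤˣ) (K : Subgroup G) : ℂ[G] :=
  ∑ q : K, MonoidAlgebra.single (q : G) ((χ q : ℤ) : ℂ)

theorem finrank_range_eq_of_ker_eq {U V W : Type*} [AddCommGroup U] [Module ℂ U] [AddCommGroup V]
    [Module ℂ V] [AddCommGroup W] [Module ℂ W] {f : U →ₗ[ℂ] V} {g : U →ₗ[ℂ] W}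
    (h : LinearMap.ker f = LinearMap.ker g) :
    Module.finrank ℂ (LinearMap.range f) = Module.finrank ℂ (LinearMap.range g) :=
  (f.quotKerEquivRange.symm ≪≫ₗ Submodule.quotEquivOfEq _ _ h ≪≫ₗ g.quotKerEquivRange).finrank_eq

open Classical in
theorem rep_subgroupSum [Fintype G] {W : Type*} [AddCommGroup W] [Module ℂ W]
    (σ : Representation ℂ G W) (H : Subgroup G) (v : W) :
    σ.asAlgebraHom (subgroupSum H) v = ∑ p : H, σ p v := by
  simp only [subgroupSum, map_sum, LinearMap.sum_apply, Representation.asAlgebraHom_single_one]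

open Classical in
theorem rep_charSum [Fintype G] {W : Type*} [AddCommGroup W] [Module ℂ W]
    (σ : Representation ℂ G W) (χ : G →* ℤˣ) (K : Subgroup G)
    (v : W) :
    σ.asAlgebraHom (charSum χ K) v = ∑ q : K, ((χ q : ℤ) : ℂ) • σ q v := by
  simp only [charSum, map_sum, LinearMap.sum_apply, Representation.asAlgebraHom_single,
    LinearMap.smul_apply]

variable {Y : Type*} [MulAction G Y]

/-- The projection onto the orbits of a subgroup. -/
def orbitProj (H : Subgroup G) (Y : Type*) [MulAction G Y] :
    (Y →₀ ℂ) →ₗ[ℂ] (MulAction.orbitRel.Quotient H Y →₀ ℂ) :=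
  Finsupp.lmapDomain ℂ ℂ (Quotient.mk _)

section Rep

variable {ρ : Representation ℂ G (Y →₀ ℂ)}

theorem orbitProj_rep (hρ : ∀ g y r, ρ g (Finsupp.single y r) = Finsupp.single (g • y) r)
    (H : Subgroup G) {h : G} (hh : h ∈ H) (v : Y →₀ ℂ) :
    orbitProj H Y (ρ h v) = orbitProj H Y v := by
  induction v using Finsupp.induction_linear with
  | zero => simp
  | add v w hv hw => simp only [map_add, hv, hw]
  | single y r =>
    rw [hρ, orbitProj, Finsupp.lmapDomain_apply, Finsupp.lmapDomain_apply, Finsupp.mapDomain_single,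
      Finsupp.mapDomain_single]
    congr 1
    exact Quotient.sound ⟨⟨h, hh⟩, rfl⟩

variable [Fintype G]

/-- Projecting the `H`-sum of `v` to orbits gives `|H|` times the projection of `v`, and `|H|` is
invertible. Conversely, the `H`-sum of a basis vector depends only on its orbit, so it factors
through the projection. -/
theorem ker_subgroupSum (hρ : ∀ g y r, ρ g (Finsupp.single y r) = Finsupp.single (g • y) r)
    (H : Subgroup G) :
    LinearMap.ker (ρ.asAlgebraHom (subgroupSum H)) = LinearMap.ker (orbitProj H Y) := by
  classical
  apply le_antisymm
  · intro v (hv : ρ.asAlgebraHom (subgroupSum H) v = 0)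
    have h1 := congrArg (orbitProj H Y) hv
    rw [rep_subgroupSum, map_sum, Finset.sum_congr rfl fun p _ => orbitProj_rep hρ H p.2 v,
      map_zero, Finset.sum_const, Finset.card_univ, ← Nat.cast_smul_eq_nsmul ℂ] at h1
    exact (smul_eq_zero.1 h1).resolve_left (Nat.cast_ne_zero.2 Fintype.card_ne_zero)
  · let L : (MulAction.orbitRel.Quotient H Y →₀ ℂ) →ₗ[ℂ] (Y →₀ ℂ) :=
      Finsupp.linearCombination ℂ (Quotient.lift
        (fun y => ρ.asAlgebraHom (subgroupSum H) (Finsupp.single y 1)) (by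
          rintro _ y ⟨h, rfl⟩
          simp only [rep_subgroupSum, hρ]
          exact Fintype.sum_equiv (Equiv.mulRight h) _ _ fun p => by
            simp [mul_smul, Subgroup.smul_def]))
    have hL : L ∘ₗ orbitProj H Y = ρ.asAlgebraHom (subgroupSum H) := by
      refine Finsupp.lhom_ext' fun y => LinearMap.ext_ring ?_
      simp [L, orbitProj]
    rw [← hL]
    exact LinearMap.ker_le_ker_comp _ _

/-- Orbit spaces for different `n` can be compared directly, whereas the row sums themselves are
taken over groups of different orders. -/
theorem finrank_range_subgroupSum {V : Type*} [AddCommGroup V] [Module ℂ V]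
    (hρ : ∀ g y r, ρ g (Finsupp.single y r) = Finsupp.single (g • y) r)
    (H : Subgroup G) (b : ℂ[G]) (Φ : V →ₗ[ℂ] (Y →₀ ℂ)) :
    Module.finrank ℂ (LinearMap.range (ρ.asAlgebraHom (subgroupSum H * b) ∘ₗ Φ)) =
      Module.finrank ℂ (LinearMap.range (orbitProj H Y ∘ₗ ρ.asAlgebraHom b ∘ₗ Φ)) := by
  apply finrank_range_eq_of_ker_eq
  rw [map_mul, Module.End.mul_eq_comp, LinearMap.comp_assoc, LinearMap.ker_comp,
    ker_subgroupSum hρ, ← LinearMap.ker_comp]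

end Rep

end GroupSums

/-! ### Transfer of ranks between permutation modules of two groups -/

section Comparison

variable {G G' : Type*} [Group G] [Group G'] [Fintype G] [Fintype G']
  {X Y X' Y' : Type*} [MulAction G Y] [MulAction G' X'] [MulAction G' Y']
  {ρY : Representation ℂ G (Y →₀ ℂ)} {ρX' : Representation ℂ G' (X' →₀ ℂ)}
  {ρY' : Representation ℂ G' (Y' →₀ ℂ)}

/-- Comparison of the ranks of a row sum times a signed column sum on two permutation
representations of two groups. -/
theorem finrank_range_comparison
    (hY : ∀ g y r, ρY g (Finsupp.single y r) = Finsupp.single (g • y) r)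
    (hX' : ∀ g y r, ρX' g (Finsupp.single y r) = Finsupp.single (g • y) r)
    (hY' : ∀ g y r, ρY' g (Finsupp.single y r) = Finsupp.single (g • y) r)
    {H K : Subgroup G} {H' K' : Subgroup G'} {χ : G →* ℤˣ} {χ' : G' →* ℤˣ}
    {iX : X → X'} {iY : Y → Y'}
    {Φ : (X →₀ ℂ) →ₗ[ℂ] (Y →₀ ℂ)} {Φ' : (X' →₀ ℂ) →ₗ[ℂ] (Y' →₀ ℂ)}
    (hnat : ∀ v, Φ' (Finsupp.mapDomain iX v) = Finsupp.mapDomain iY (Φ v))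
    (heq : ∀ g v, Φ' (ρX' g v) = ρY' g (Φ' v))
    (hH : ∀ h ∈ H, ∃ h' ∈ H', ∀ y, iY (h • y) = h' • iY y)
    (hinj : ∀ h' ∈ H', ∀ y₁ y₂, h' • iY y₁ = iY y₂ → ∃ h ∈ H, h • y₁ = y₂)
    (θ : K ≃ K') (hθ : ∀ q y, iY (q • y) = θ q • iY y)
    (hχ : ∀ q, χ' (θ q : G') = χ (q : G))
    (hsurj : ∀ x', (∃ t ∈ K', t • x' = x' ∧ χ' t = -1) ∨
      ∃ x, ∃ r ∈ H', (∀ q ∈ K', Commute r q) ∧ r • x' = iX x) :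
    Module.finrank ℂ (LinearMap.range (ρY.asAlgebraHom (subgroupSum H * charSum χ K) ∘ₗ Φ)) =
      Module.finrank ℂ
        (LinearMap.range (ρY'.asAlgebraHom (subgroupSum H' * charSum χ' K') ∘ₗ Φ')) := by
  classical
  rw [finrank_range_subgroupSum hY, finrank_range_subgroupSum hY']
  let iQ : MulAction.orbitRel.Quotient H Y → MulAction.orbitRel.Quotient H' Y' :=
    Quotient.map iY (by
      rintro _ y ⟨h, rfl⟩
      obtain ⟨h', hh', he⟩ := hH h h.2
      exact ⟨⟨h', hh'⟩, (he y).symm⟩)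
  have hiQ : Function.Injective iQ := by
    intro a b
    induction a using Quotient.inductionOn
    induction b using Quotient.inductionOn
    rename_i a b
    intro hab
    obtain ⟨h', hh'⟩ := Quotient.exact hab
    obtain ⟨h, hh, he⟩ := hinj h' h'.2 b a hh'
    exact Quotient.sound ⟨⟨h, hh⟩, he⟩
  let J := Finsupp.lmapDomain ℂ ℂ iQ
  have hJ : Function.Injective J := Finsupp.mapDomain_injective hiQ
  have hJπ (v : Y →₀ ℂ) : J (orbitProj H Y v) = orbitProj H' Y' (Finsupp.mapDomain iY v) := by
    simp only [J, orbitProj, Finsupp.lmapDomain_apply, ← Finsupp.mapDomain_comp]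
    rfl
  have hiρ (q : K) (v : Y →₀ ℂ) :
      Finsupp.mapDomain iY (ρY q v) = ρY' (θ q) (Finsupp.mapDomain iY v) := by
    induction v using Finsupp.induction_linear with
    | zero => simp
    | add v w hv hw => simp only [map_add, Finsupp.mapDomain_add, hv, hw]
    | single y r =>
      rw [hY, Finsupp.mapDomain_single, Finsupp.mapDomain_single, hY']
      congr 1
      exact hθ q y
  have hib (v : Y →₀ ℂ) : Finsupp.mapDomain iY (ρY.asAlgebraHom (charSum χ K) v) =
      ρY'.asAlgebraHom (charSum χ' K') (Finsupp.mapDomain iY v) := by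
    rw [rep_charSum, rep_charSum, Finsupp.mapDomain_finsetSum]
    refine Fintype.sum_equiv θ _ _ fun q => ?_
    rw [Finsupp.mapDomain_smul, hiρ, hχ]
  have hcomm (v : X →₀ ℂ) :
      J ((orbitProj H Y ∘ₗ ρY.asAlgebraHom (charSum χ K) ∘ₗ Φ) v) =
        (orbitProj H' Y' ∘ₗ ρY'.asAlgebraHom (charSum χ' K') ∘ₗ Φ') (Finsupp.mapDomain iX v) := by
    simp only [LinearMap.comp_apply, hJπ, hib, hnat]
  have hrange : LinearMap.range (orbitProj H' Y' ∘ₗ ρY'.asAlgebraHom (charSum χ' K') ∘ₗ Φ') =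
      (LinearMap.range (orbitProj H Y ∘ₗ ρY.asAlgebraHom (charSum χ K) ∘ₗ Φ)).map J := by
    apply le_antisymm
    · rintro _ ⟨v', rfl⟩
      induction v' using Finsupp.induction_linear with
      | zero => rw [map_zero]; exact zero_mem _
      | add v w hv hw => rw [map_add]; exact add_mem hv hw
      | single x' s =>
        rcases hsurj x' with ⟨t, ht, htx, hχt⟩ | ⟨x, r, hr, hrc, hrx⟩
        · set w := Φ' (Finsupp.single x' s)
          have hw : ρY' t w = w := by rw [← heq, hX', htx]
          -- Reindexing the signed sum by right multiplication by `t`, which fixes `w` and has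
          -- character `-1`, changes its sign.
          have h1 : ρY'.asAlgebraHom (charSum χ' K') w =
              -ρY'.asAlgebraHom (charSum χ' K') w := by
            conv_lhs => rw [← hw]
            rw [rep_charSum, rep_charSum, ← Finset.sum_neg_distrib]
            refine Fintype.sum_equiv (Equiv.mulRight ⟨t, ht⟩) _ _ fun q => ?_
            simp [hχt, map_mul]
          have h2 := self_eq_neg.1 h1
          simp only [LinearMap.comp_apply, w] at h2 ⊢
          rw [h2, map_zero]
          exact zero_mem _
        -- Since `r` commutes with the column group, it passes through the signed sum and is
        -- absorbed by the orbit projection; so `x'` may be replaced by `r • x'`.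
        · refine ⟨_, ⟨Finsupp.single x s, rfl⟩, ?_⟩
          rw [hcomm, Finsupp.mapDomain_single, ← hrx, ← hX']
          simp only [LinearMap.comp_apply]
          rw [heq]
          have h1 : ρY'.asAlgebraHom (charSum χ' K') (ρY' r (Φ' (Finsupp.single x' s))) =
              ρY' r (ρY'.asAlgebraHom (charSum χ' K') (Φ' (Finsupp.single x' s))) := by
            simp only [rep_charSum, map_sum, map_smul]
            refine Finset.sum_congr rfl fun q _ => ?_
            rw [← Module.End.mul_apply, ← Module.End.mul_apply, ← map_mul, ← map_mul,
              (hrc q q.2).eq]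
          rw [h1, orbitProj_rep hY' H' hr]
    · rintro _ ⟨_, ⟨v, rfl⟩, rfl⟩
      exact ⟨_, (hcomm v).symm⟩
  rw [hrange]
  exact (Submodule.equivMapOfInjective J hJ _).finrank_eq

end Comparison

/-! ### Isolated points -/

/-- A point forming a block of its own. -/
def IsIsolated {α : Type*} (σ : Setoid α) (p : α) : Prop := ∀ q, σ p q → q = p

section Isolated

variable {n : ℕ}

/-- Each block has at least two points or is a single isolated one, so twice the number of blocks is
at most `n` plus the number of isolated points. -/
theorem le_two_mul_rank_add (σ : Setoid (Fin n)) :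
    n ≤ 2 * rank σ + Nat.card {p // IsIsolated σ p} := by
  classical
  have h1 : Fintype.card (Quotient σ) * 2 ≤ n + Fintype.card {p // IsIsolated σ p} := by
    have e1 := Finset.card_eq_sum_card_fiberwise (f := Quotient.mk σ) (s := Finset.univ)
      (t := Finset.univ) (by simp)
    have e2 := Finset.card_eq_sum_card_fiberwise (f := Quotient.mk σ)
      (s := Finset.univ.filter (IsIsolated σ)) (t := Finset.univ) (by simp)
    rw [Finset.card_univ, Fintype.card_fin] at e1
    rw [Fintype.card_subtype, e2, ← Finset.card_univ, ← smul_eq_mul, ← Finset.sum_const]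
    refine le_of_le_of_eq ?_ (congrArg (· + _) e1.symm)
    rw [← Finset.sum_add_distrib]
    refine Finset.sum_le_sum fun q _ => ?_
    obtain ⟨a, rfl⟩ := Quotient.exists_rep q
    by_cases ha : IsIsolated σ a
    · have h2 : 0 < (Finset.univ.filter fun x => Quotient.mk σ x = Quotient.mk σ a).card :=
        Finset.card_pos.2 ⟨a, by simp⟩
      have h3 : 0 < ((Finset.univ.filter (IsIsolated σ)).filter
          fun x => Quotient.mk σ x = Quotient.mk σ a).card :=
        Finset.card_pos.2 ⟨a, by simp [ha]⟩
      omega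
    · simp only [IsIsolated, not_forall] at ha
      obtain ⟨b, hab, hne⟩ := ha
      have h2 : 1 < (Finset.univ.filter fun x => Quotient.mk σ x = Quotient.mk σ a).card :=
        Finset.one_lt_card.2 ⟨a, by simp, b, by simpa using Quotient.sound (σ.symm hab),
          Ne.symm hne⟩
      omega
  have h2 := card_quotient_le σ
  rw [Nat.card_eq_fintype_card] at h2 ⊢
  rw [rank, Nat.card_eq_fintype_card]
  omega

theorem IsIsolated.perm {σ : Setoid (Fin n)} {p : Fin n} (h : IsIsolated σ p)
    (g : Equiv.Perm (Fin n)) : IsIsolated (permPartition g σ) (g p) := by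
  intro q hq
  have hq' : σ (g⁻¹ (g p)) (g⁻¹ q) := hq
  rw [show g⁻¹ (g p) = p from g.symm_apply_apply p] at hq'
  exact g.symm_apply_eq.1 (h _ hq')

theorem permPartition_swap {σ : Setoid (Fin n)} {p q : Fin n} (hp : IsIsolated σ p)
    (hq : IsIsolated σ q) : permPartition (Equiv.swap p q) σ = σ := by
  have key (u v : Fin n) (h : σ u v) : σ (Equiv.swap p q u) (Equiv.swap p q v) := by
    by_cases hup : u = p
    · subst hup; rw [hp v h]
    by_cases huq : u = q
    · subst huq; rw [hq v h]
    have hvp : v ≠ p := by rintro rfl; exact hup (hp u (σ.symm h))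
    have hvq : v ≠ q := by rintro rfl; exact huq (hq u (σ.symm h))
    rwa [Equiv.swap_apply_of_ne_of_ne hup huq, Equiv.swap_apply_of_ne_of_ne hvp hvq]
  ext u v
  change σ ((Equiv.swap p q)⁻¹ u) ((Equiv.swap p q)⁻¹ v) ↔ σ u v
  rw [Equiv.swap_inv]
  exact ⟨fun h => by simpa using key _ _ h, key u v⟩

end Isolated

/-! ### Extending a partition by isolated points -/

section Extend

variable {α β : Type*}

/-- The partition of `β` obtained from a partition of `α` along an embedding, with all points
outside the range isolated. -/
def extendPartition (j : α ↪ β) (π : Setoid α) : Setoid β where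
  r x y := x = y ∨ ∃ a b, π a b ∧ j a = x ∧ j b = y
  iseqv :=
    { refl := fun _ => Or.inl rfl
      symm := by
        rintro x y (rfl | ⟨a, b, h, ha, hb⟩)
        · exact Or.inl rfl
        · exact Or.inr ⟨b, a, π.symm h, hb, ha⟩
      trans := by
        rintro x y w (rfl | ⟨a, b, h, rfl, rfl⟩) hyw
        · exact hyw
        · rcases hyw with rfl | ⟨c, d, h', hc, rfl⟩
          · exact Or.inr ⟨a, b, h, rfl, rfl⟩
          · obtain rfl := j.injective hc
            exact Or.inr ⟨a, d, π.trans h h', rfl, rfl⟩ }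

theorem extendPartition_apply (j : α ↪ β) (π : Setoid α) (a b : α) :
    extendPartition j π (j a) (j b) ↔ π a b := by
  constructor
  · rintro (h | ⟨c, d, h, hc, hd⟩)
    · rw [j.injective h]
    · rwa [← j.injective hc, ← j.injective hd]
  · exact fun h => Or.inr ⟨a, b, h, rfl, rfl⟩

theorem extendPartition_le_iff (j : α ↪ β) {π σ : Setoid α} :
    extendPartition j π ≤ extendPartition j σ ↔ π ≤ σ := by
  constructor
  · intro h a b hab
    exact (extendPartition_apply j σ a b).1 (h ((extendPartition_apply j π a b).2 hab))
  · rintro h x y (rfl | ⟨a, b, hab, rfl, rfl⟩)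
    · exact Or.inl rfl
    · exact Or.inr ⟨a, b, h hab, rfl, rfl⟩

theorem isIsolated_extendPartition {j : α ↪ β} {z : β} (hz : ∀ a, j a ≠ z) (π : Setoid α) :
    IsIsolated (extendPartition j π) z := by
  rintro q (rfl | ⟨a, b, -, ha, -⟩)
  · rfl
  · exact absurd ha (hz a)

/-- Identifies the image of the extension map as the partitions isolating `z`. -/
theorem extendPartition_comap {j : α ↪ β} {z : β} (hj : ∀ x, x = z ∨ ∃ a, j a = x) {σ : Setoid β}
    (hσ : IsIsolated σ z) : extendPartition j (Setoid.comap j σ) = σ := by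
  ext x y
  constructor
  · rintro (rfl | ⟨a, b, h, rfl, rfl⟩)
    · exact σ.refl x
    · exact h
  · intro h
    rcases hj x with rfl | ⟨a, rfl⟩
    · exact Or.inl (hσ y h).symm
    · rcases hj y with rfl | ⟨b, rfl⟩
      · exact Or.inl (hσ _ (σ.symm h))
      · exact Or.inr ⟨a, b, h, rfl, rfl⟩

theorem card_quotient_extendPartition [Finite α] {j : α ↪ β} {z : β} (hz : ∀ a, j a ≠ z)
    (hj : ∀ x, x = z ∨ ∃ a, j a = x) (π : Setoid α) :
    Nat.card (Quotient (extendPartition j π)) = Nat.card (Quotient π) + 1 := by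
  -- The only new block is that of `z`, matched with `none`.
  let f : Option (Quotient π) → Quotient (extendPartition j π) := fun o =>
    o.elim (Quotient.mk _ z) (Quotient.map j fun a b h => (extendPartition_apply j π a b).2 h)
  have hf : Function.Bijective f := by
    constructor
    · intro o o' h
      cases o with
      | none =>
        cases o' with
        | none => rfl
        | some q' =>
          induction q' using Quotient.inductionOn with | h b
          exact absurd (isIsolated_extendPartition hz π _ (Quotient.exact h)) (hz b)
      | some q =>
        induction q using Quotient.inductionOn with | h a
        cases o' with
        | none =>
          exact absurd (isIsolated_extendPartition hz π _ (Quotient.exact h.symm)) (hz a)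
        | some q' =>
          induction q' using Quotient.inductionOn with | h b
          exact congrArg some (Quotient.sound ((extendPartition_apply j π a b).1 (Quotient.exact h)))
    · intro q
      induction q using Quotient.inductionOn with | h x
      rcases hj x with rfl | ⟨a, rfl⟩
      · exact ⟨none, rfl⟩
      · exact ⟨some (Quotient.mk π a), rfl⟩
  rw [← Nat.card_eq_of_bijective f hf, Finite.card_option]

variable {n : ℕ} {j : Fin n ↪ Fin (n + 1)} {z : Fin (n + 1)}

theorem rank_extendPartition (hz : ∀ a, j a ≠ z) (hj : ∀ x, x = z ∨ ∃ a, j a = x)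
    (π : Setoid (Fin n)) : rank (extendPartition j π) = rank π := by
  rw [rank, rank, card_quotient_extendPartition hz hj, Nat.add_sub_add_right]

theorem permPartition_extendPartition (π : Setoid (Fin n)) {g : Equiv.Perm (Fin n)}
    {g' : Equiv.Perm (Fin (n + 1))} (hg : ∀ a, j (g a) = g' (j a)) :
    permPartition g' (extendPartition j π) = extendPartition j (permPartition g π) := by
  ext x y
  change (g'⁻¹ x = g'⁻¹ y ∨ ∃ a b, π a b ∧ j a = g'⁻¹ x ∧ j b = g'⁻¹ y) ↔
    (x = y ∨ ∃ a b, π (g⁻¹ a) (g⁻¹ b) ∧ j a = x ∧ j b = y)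
  refine or_congr g'⁻¹.injective.eq_iff ⟨?_, ?_⟩
  · rintro ⟨a, b, h, ha, hb⟩
    exact ⟨g a, g b, by simpa using h, by simp [hg, ha], by simp [hg, hb]⟩
  · rintro ⟨a, b, h, rfl, rfl⟩
    refine ⟨_, _, h, ?_, ?_⟩
    · rw [Equiv.Perm.eq_inv_iff_eq, ← hg]
      exact congrArg j (g.apply_symm_apply _)
    · rw [Equiv.Perm.eq_inv_iff_eq, ← hg]
      exact congrArg j (g.apply_symm_apply _)

end Extend

/-! ### Chains of partitions -/

section Chains

variable {n m : ℕ} {S : Finset ℕ}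

instance chainAction : MulAction (Equiv.Perm (Fin n)) (Fin m ↪o RankSelected n S) where
  smul g x := x.trans (permAut n S g).toOrderEmbedding
  one_smul _ := rfl
  mul_smul _ _ _ := rfl

/-- The representation of the symmetric group on the simplicial chains of `Π_n(S)`. -/
def partitionChainRep (S : Finset ℕ) (n m : ℕ) : Representation ℂ (Equiv.Perm (Fin n))
    (SimplicialChains ℂ (RankSelected n S) m) :=
  (chainRep ℂ (RankSelected n S) m).comp (permAut n S)

theorem partitionChainRep_single (g : Equiv.Perm (Fin n)) (x : Fin m ↪o RankSelected n S) (r : ℂ) :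
    partitionChainRep S n m g (Finsupp.single x r) = Finsupp.single (g • x) r :=
  Finsupp.mapDomain_single

/-- A point isolated in every member of a chain of partitions. -/
def IsChainIsolated (x : Fin m ↪o RankSelected n S) (p : Fin n) : Prop :=
  ∀ i, IsIsolated (x i).1 p

theorem chain_ext {x y : Fin m ↪o RankSelected n S} (h : ∀ i, (x i).1 = (y i).1) : x = y :=
  DFunLike.ext _ _ fun i => Subtype.ext (h i)

theorem IsChainIsolated.smul {x : Fin m ↪o RankSelected n S} {p : Fin n}
    (h : IsChainIsolated x p) (g : Equiv.Perm (Fin n)) : IsChainIsolated (g • x) (g p) :=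
  fun i => (h i).perm g

theorem swap_smul_chain {x : Fin m ↪o RankSelected n S} {p q : Fin n}
    (hp : IsChainIsolated x p) (hq : IsChainIsolated x q) : Equiv.swap p q • x = x :=
  chain_ext fun i => permPartition_swap (hp i) (hq i)

/-- A point isolated in the top member is isolated in every finer one, so only the top member has to
be counted; the chain must therefore be nonempty. -/
theorem le_card_isChainIsolated {M : ℕ} (hM : ∀ s ∈ S, s ≤ M)
    (x : Fin (m + 1) ↪o RankSelected n S) :
    n ≤ 2 * M + Nat.card {p // IsChainIsolated x p} := by
  have h1 := le_two_mul_rank_add (x (Fin.last m)).1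
  have h2 := hM _ (x (Fin.last m)).2
  have h3 : Nat.card {p // IsIsolated (x (Fin.last m)).1 p} ≤
      Nat.card {p // IsChainIsolated x p} :=
    Nat.card_le_card_of_injective
      (fun p => ⟨p.1, fun i q hq => p.2 q (x.monotone (Fin.le_last i) hq)⟩)
      fun p q hpq => Subtype.ext (Subtype.mk.inj hpq)
  omega

variable {j : Fin n ↪ Fin (n + 1)} {z : Fin (n + 1)}

/-- Extending the members of `Π_n(S)` by an isolated point. -/
def extendRankSelected (S : Finset ℕ) (hz : ∀ a, j a ≠ z) (hj : ∀ x, x = z ∨ ∃ a, j a = x) :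
    RankSelected n S ↪o RankSelected (n + 1) S :=
  OrderEmbedding.ofMapLEIff
    (fun π => ⟨extendPartition j π.1, by rw [rank_extendPartition hz hj]; exact π.2⟩)
    fun _ _ => extendPartition_le_iff j

theorem smul_chain_extend (hz : ∀ a, j a ≠ z) (hj : ∀ x, x = z ∨ ∃ a, j a = x)
    {g : Equiv.Perm (Fin n)} {g' : Equiv.Perm (Fin (n + 1))} (hg : ∀ a, j (g a) = g' (j a))
    (x : Fin m ↪o RankSelected n S) :
    g' • x.trans (extendRankSelected S hz hj) = (g • x).trans (extendRankSelected S hz hj) :=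
  chain_ext fun i => permPartition_extendPartition (x i).1 hg

theorem chain_extend_injective (hz : ∀ a, j a ≠ z) (hj : ∀ x, x = z ∨ ∃ a, j a = x)
    {x y : Fin m ↪o RankSelected n S}
    (h : x.trans (extendRankSelected S hz hj) = y.trans (extendRankSelected S hz hj)) : x = y :=
  DFunLike.ext _ _ fun i => (extendRankSelected S hz hj).injective (DFunLike.congr_fun h i)

theorem isChainIsolated_extend (hz : ∀ a, j a ≠ z) (hj : ∀ x, x = z ∨ ∃ a, j a = x)
    (x : Fin m ↪o RankSelected n S) : IsChainIsolated (x.trans (extendRankSelected S hz hj)) z :=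
  fun i => isIsolated_extendPartition hz (x i).1

theorem exists_chain_extend (hz : ∀ a, j a ≠ z) (hj : ∀ x, x = z ∨ ∃ a, j a = x)
    {y : Fin m ↪o RankSelected (n + 1) S} (hy : IsChainIsolated y z) :
    ∃ x : Fin m ↪o RankSelected n S, x.trans (extendRankSelected S hz hj) = y := by
  have h (i : Fin m) : extendPartition j (Setoid.comap j (y i).1) = (y i).1 :=
    extendPartition_comap hj (hy i)
  let f : Fin m → RankSelected n S := fun i => ⟨Setoid.comap j (y i).1, by
    rw [← rank_extendPartition hz hj, h]; exact (y i).2⟩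
  have hf (a b : Fin m) : f a ≤ f b ↔ a ≤ b := by
    rw [← y.le_iff_le, ← Subtype.coe_le_coe, ← Subtype.coe_le_coe, ← h a, ← h b,
      extendPartition_le_iff]
  exact ⟨OrderEmbedding.ofMapLEIff f hf, chain_ext h⟩

theorem exists_perm_of_fix (hj : ∀ x, x = z ∨ ∃ a, j a = x)
    {g' : Equiv.Perm (Fin (n + 1))} (h : g' z = z) (hz : ∀ a, j a ≠ z) :
    ∃ g : Equiv.Perm (Fin n), ∀ a, j (g a) = g' (j a) := by
  have key (a : Fin n) : ∃ b, j b = g' (j a) := (hj (g' (j a))).resolve_left fun h' =>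
    hz a (g'.injective (h'.trans h.symm))
  choose f hf using key
  have hinj : Function.Injective f := fun a b hab =>
    j.injective (g'.injective (by rw [← hf, ← hf, hab]))
  exact ⟨Equiv.ofBijective f (Finite.injective_iff_bijective.1 hinj), hf⟩

end Chains

/-! ### Stability of the rank of a hook symmetrizer -/

section HookRank

variable {n m l k : ℕ} {S : Finset ℕ}

/-- The permutations fixing all entries below the first row of a hook with first column `C` and
corner `c`. -/
abbrev hookRowGroup (C : Finset (Fin n)) (c : Fin n) : Subgroup (Equiv.Perm (Fin n)) :=
  fixingSubgroup (Equiv.Perm (Fin n)) ((C : Set (Fin n)) \ {c})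

/-- The permutations fixing all entries outside the first column of a hook with first column `C`. -/
abbrev hookColGroup (C : Finset (Fin n)) : Subgroup (Equiv.Perm (Fin n)) :=
  fixingSubgroup (Equiv.Perm (Fin n)) (C : Set (Fin n))ᶜ

theorem mem_hookRowGroup {C : Finset (Fin n)} {c : Fin n} {g : Equiv.Perm (Fin n)} :
    g ∈ hookRowGroup C c ↔ ∀ x ∈ C, x ≠ c → g x = x := by
  rw [mem_fixingSubgroup_iff]
  exact ⟨fun h x hx hc => h x ⟨hx, hc⟩, fun h x hx => h x hx.1 hx.2⟩

theorem mem_hookColGroup {C : Finset (Fin n)} {g : Equiv.Perm (Fin n)} :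
    g ∈ hookColGroup C ↔ ∀ x ∉ C, g x = x := by
  rw [mem_fixingSubgroup_iff]
  rfl

/-- The rank of the Young symmetrizer of a hook on the image of a map into simplicial chains. -/
def hookRank (C : Finset (Fin n)) (c : Fin n)
    (Φ : SimplicialChains ℂ (RankSelected n S) m →ₗ[ℂ] SimplicialChains ℂ (RankSelected n S) l) :
    ℕ :=
  Module.finrank ℂ (LinearMap.range ((partitionChainRep S n l).asAlgebraHom
    (subgroupSum (hookRowGroup C c) * charSum Equiv.Perm.sign (hookColGroup C)) ∘ₗ Φ))

theorem exists_hook_embedding {C : Finset (Fin n)} {c : Fin n} (hc : c ∈ C)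
    {C' : Finset (Fin (n + 1))} {c' : Fin (n + 1)} (hc' : c' ∈ C') (hcard : C.card = C'.card) :
    ∃ (j : Fin n ↪ Fin (n + 1)) (z : Fin (n + 1)), (∀ a, j a ≠ z) ∧ (∀ x, x = z ∨ ∃ a, j a = x) ∧
      (∀ a, j a ∈ C' ↔ a ∈ C) ∧ z ∉ C' ∧ j c = c' := by
  obtain ⟨z, hz⟩ : ∃ z, z ∉ C' := by
    by_contra! h
    have h1 : C' = Finset.univ := Finset.eq_univ_iff_forall.2 h
    have h2 := C.card_le_univ
    rw [hcard, h1, Finset.card_univ, Fintype.card_fin, Fintype.card_fin] at h2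
    omega
  let e₀ : C ≃ C' := Finset.equivOfCardEq hcard
  -- The swap corrects an arbitrary bijection so that corner goes to corner.
  let e : C ≃ C' := e₀.trans (Equiv.swap (e₀ ⟨c, hc⟩) ⟨c', hc'⟩)
  let f : Fin n → Fin (n + 1) := fun a => if h : a ∈ C then e ⟨a, h⟩ else c'
  have hfC (a : Fin n) (h : a ∈ C) : f a = e ⟨a, h⟩ := dif_pos h
  have hmaps : Set.MapsTo f C (Finset.univ.erase z : Finset (Fin (n + 1))) := by
    intro a ha
    rw [hfC a ha, Finset.coe_erase]
    refine ⟨by simp, fun h => hz ?_⟩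
    rw [← (h : _ = z)]
    exact (e ⟨a, ha⟩).2
  have hinj : Set.InjOn f C := by
    intro a ha b hb hab
    rw [hfC a ha, hfC b hb] at hab
    exact congrArg Subtype.val (e.injective (Subtype.ext hab))
  obtain ⟨g, hg⟩ := Set.MapsTo.exists_equiv_extend_of_card_eq (by simp) hmaps hinj
  let j : Fin n ↪ Fin (n + 1) := g.toEmbedding.trans (Function.Embedding.subtype _)
  have hjC (a : Fin n) (ha : a ∈ C) : j a = e ⟨a, ha⟩ := (hg a ha).trans (hfC a ha)
  have hmap : C.map j = C' := by
    refine Finset.eq_of_subset_of_card_le (fun x hx => ?_) (by rw [Finset.card_map, hcard])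
    obtain ⟨a, ha, rfl⟩ := Finset.mem_map.1 hx
    rw [hjC a ha]
    exact (e _).2
  refine ⟨j, z, fun a => Finset.ne_of_mem_erase (g a).2, fun x => ?_, fun a => ?_, hz, ?_⟩
  · by_cases hx : x = z
    · exact Or.inl hx
    · exact Or.inr ⟨g.symm ⟨x, by simp [hx]⟩, by simp [j]⟩
  · rw [← hmap, Finset.mem_map' j]
  · rw [hjC c hc]
    simp [e]

/-- A chain of partitions with many isolated points is fixed by an odd column permutation, or is
moved by a row permutation commuting with the column group to one isolating a given point outside
the first column. -/
theorem exists_swap_of_isChainIsolated {C : Finset (Fin n)} {c z : Fin n} (hc : c ∈ C)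
    (hcard : C.card = k + 1) (hz : z ∉ C) (x : Fin m ↪o RankSelected n S)
    (hx : k + 1 ≤ Nat.card {p // IsChainIsolated x p}) :
    (∃ t ∈ hookColGroup C, t • x = x ∧ Equiv.Perm.sign t = -1) ∨
      ∃ r ∈ hookRowGroup C c, (∀ q ∈ hookColGroup C, Commute r q) ∧ IsChainIsolated (r • x) z := by
  classical
  rw [Nat.card_eq_fintype_card, Fintype.card_subtype] at hx
  set I := Finset.univ.filter (IsChainIsolated x)
  have hI (p : Fin n) : p ∈ I ↔ IsChainIsolated x p := by simp [I]
  have hmove (p : Fin n) (hp : p ∈ I) : IsChainIsolated (Equiv.swap p z • x) z := by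
    simpa using ((hI p).1 hp).smul (Equiv.swap p z)
  have hne {a : Fin n} (ha : a ∈ C) : a ≠ z := fun h => hz (h ▸ ha)
  by_cases hIC : I ⊆ C
  -- For `k = 0` there may be only one isolated point, but the column group is trivial and the row
  -- group is everything. For `k ≥ 1` two isolated points lie in the column, and their transposition
  -- is odd.
  · rcases Nat.eq_zero_or_pos k with rfl | hk
    · right
      obtain ⟨c₁, hc₁⟩ := Finset.card_eq_one.1 hcard
      obtain ⟨p, hp⟩ := Finset.card_pos.1 (by omega : 0 < I.card)
      have hCc (a : Fin n) (ha : a ∈ C) : a = c := by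
        rw [hc₁, Finset.mem_singleton] at ha hc
        rw [ha, hc]
      refine ⟨Equiv.swap p z, mem_hookRowGroup.2 fun a ha hac => absurd (hCc a ha) hac, ?_,
        hmove p hp⟩
      intro q hq
      have : q = 1 := by
        refine Equiv.ext fun a => ?_
        by_cases ha : a ∈ C
        · by_contra h
          have h1 : q (q a) = q a := mem_hookColGroup.1 hq _ fun h2 =>
            h ((hCc _ h2).trans (hCc a ha).symm)
          exact h (q.injective h1)
        · exact mem_hookColGroup.1 hq a ha
      rw [this]
      exact Commute.one_right _
    · left
      obtain ⟨p, hp, q, hq, hpq⟩ := Finset.one_lt_card.1 (by omega : 1 < I.card)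
      refine ⟨Equiv.swap p q, mem_hookColGroup.2 fun a ha => ?_,
        swap_smul_chain ((hI p).1 hp) ((hI q).1 hq), Equiv.Perm.sign_swap hpq⟩
      exact Equiv.swap_apply_of_ne_of_ne (fun h => ha (h ▸ hIC hp)) fun h => ha (h ▸ hIC hq)
  · right
    obtain ⟨p, hp, hpC⟩ := Finset.not_subset.1 hIC
    have hfix (a : Fin n) (ha : a ∈ C) : Equiv.swap p z a = a :=
      Equiv.swap_apply_of_ne_of_ne (fun h => hpC (h ▸ ha)) (hne ha)
    refine ⟨Equiv.swap p z, mem_hookRowGroup.2 fun a ha _ => hfix a ha, fun q hq => ?_,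
      hmove p hp⟩
    refine Equiv.Perm.Disjoint.commute fun a => ?_
    by_cases ha : a ∈ C
    · exact Or.inl (hfix a ha)
    · exact Or.inr (mem_hookColGroup.1 hq a ha)

/-- The comparison is made along an embedding that matches columns and corners and omits a point `z`
outside the new column. The hooks on the two sides are arbitrary, which later gives independence of
the hook as well. -/
theorem hookRank_succ {M : ℕ} (hM : ∀ s ∈ S, s ≤ M) (hn : 2 * M + k ≤ n)
    {C : Finset (Fin n)} {c : Fin n} (hc : c ∈ C) (hcard : C.card = k + 1)
    {C' : Finset (Fin (n + 1))} {c' : Fin (n + 1)} (hc' : c' ∈ C') (hcard' : C'.card = k + 1)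
    {Φ : SimplicialChains ℂ (RankSelected n S) (m + 1) →ₗ[ℂ]
      SimplicialChains ℂ (RankSelected n S) l}
    {Φ' : SimplicialChains ℂ (RankSelected (n + 1) S) (m + 1) →ₗ[ℂ]
      SimplicialChains ℂ (RankSelected (n + 1) S) l}
    (hnat : ∀ (e : RankSelected n S ↪o RankSelected (n + 1) S) v,
      Φ' (Finsupp.mapDomain (fun x => x.trans e) v) = Finsupp.mapDomain (fun x => x.trans e) (Φ v))
    (heq : ∀ g v, Φ' (partitionChainRep S (n + 1) (m + 1) g v) =
      partitionChainRep S (n + 1) l g (Φ' v)) :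
    hookRank C c Φ = hookRank C' c' Φ' := by
  classical
  obtain ⟨j, z, hz, hj, hjC, hzC, hjc⟩ := exists_hook_embedding hc hc' (hcard.trans hcard'.symm)
  let v (g : Equiv.Perm (Fin n)) : Equiv.Perm (Fin (n + 1)) := g.viaFintypeEmbedding j
  have hv (g : Equiv.Perm (Fin n)) (a : Fin n) : j (g a) = v g (j a) :=
    (g.viaFintypeEmbedding_apply_image j a).symm
  have hvz (g : Equiv.Perm (Fin n)) : v g z = z :=
    g.viaFintypeEmbedding_apply_notMem_range j fun ⟨a, ha⟩ => hz a ha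
  have hcol (q : Equiv.Perm (Fin n)) (hq : q ∈ hookColGroup C) : v q ∈ hookColGroup C' := by
    refine mem_hookColGroup.2 fun x hx => ?_
    rcases hj x with rfl | ⟨a, rfl⟩
    · exact hvz q
    · rw [← hv, mem_hookColGroup.1 hq a fun ha => hx ((hjC a).2 ha)]
  let θ : hookColGroup C → hookColGroup C' := fun q => ⟨v q, hcol q q.2⟩
  have hθ : Function.Bijective θ := by
    constructor
    · intro q q' h
      have h' : v q = v q' := congrArg Subtype.val h
      refine Subtype.ext (Equiv.ext fun a => j.injective ?_)
      rw [hv, hv, h']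
    · rintro ⟨q', hq'⟩
      obtain ⟨q, hq⟩ := exists_perm_of_fix hj (mem_hookColGroup.1 hq' z hzC) hz
      refine ⟨⟨q, mem_hookColGroup.2 fun a ha => j.injective ?_⟩,
        Subtype.ext (Equiv.ext fun x => ?_)⟩
      · rw [hq, mem_hookColGroup.1 hq' _ fun h => ha ((hjC a).1 h)]
      · rcases hj x with rfl | ⟨a, rfl⟩
        · exact (hvz q).trans (mem_hookColGroup.1 hq' _ hzC).symm
        · exact (hv q a).symm.trans (hq a)
  refine finrank_range_comparison (iX := fun x => x.trans (extendRankSelected S hz hj))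
    (iY := fun x => x.trans (extendRankSelected S hz hj)) partitionChainRep_single
    partitionChainRep_single partitionChainRep_single (hnat _) heq ?_ ?_ (Equiv.ofBijective θ hθ)
    ?_ ?_ ?_
  · intro h hh
    refine ⟨v h, mem_hookRowGroup.2 fun x hx hxc => ?_, fun y =>
      (smul_chain_extend hz hj (hv h) y).symm⟩
    rcases hj x with rfl | ⟨a, rfl⟩
    · exact hvz h
    · rw [← hv, mem_hookRowGroup.1 hh a ((hjC a).1 hx) fun ha => hxc (by rw [ha, hjc])]
  · intro h' hh' y₁ y₂ hy
    -- Both `z` and `h' z` are isolated in the extension of `y₂`, so following `h'` by their swap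
    -- still reaches it. The product fixes `z` and hence comes from a permutation of `Fin n`.
    have hp : IsChainIsolated (y₂.trans (extendRankSelected S hz hj)) (h' z) :=
      hy ▸ (isChainIsolated_extend hz hj y₁).smul h'
    have hs := swap_smul_chain hp (isChainIsolated_extend hz hj y₂)
    obtain ⟨h, hh⟩ := exists_perm_of_fix hj (g' := Equiv.swap (h' z) z * h') (by simp) hz
    refine ⟨h, mem_hookRowGroup.2 fun a ha hac => j.injective ?_, ?_⟩
    · have h1 : h' (j a) = j a := mem_hookRowGroup.1 hh' _ ((hjC a).2 ha) fun e =>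
        hac (j.injective (e.trans hjc.symm))
      rw [hh, Equiv.Perm.mul_apply, h1]
      refine Equiv.swap_apply_of_ne_of_ne (fun e => hz a (h'.injective ?_)) (hz a)
      rw [h1, e]
    · apply chain_extend_injective hz hj
      rw [← smul_chain_extend hz hj hh, mul_smul, hy, hs]
  · exact fun q y => (smul_chain_extend hz hj (hv q) y).symm
  · exact fun q => Equiv.Perm.viaFintypeEmbedding_sign _ _
  · intro x'
    -- The stable range enters here: `n + 1 ≤ 2M + #isolated` and `2M + k ≤ n` leave at least `k +
    -- 1` isolated points.
    have h1 := le_card_isChainIsolated hM x'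
    refine (exists_swap_of_isChainIsolated hc' hcard' hzC x' (by omega)).imp_right ?_
    rintro ⟨r, hr, hrc, hrz⟩
    obtain ⟨x, hx⟩ := exists_chain_extend hz hj hrz
    exact ⟨x, r, hr, hrc, hx.symm⟩

theorem exists_hook (h : k < n) : ∃ C : Finset (Fin n), ∃ c ∈ C, C.card = k + 1 := by
  obtain ⟨C, -, hC⟩ := Finset.exists_subset_card_eq (s := (Finset.univ : Finset (Fin n)))
    (n := k + 1) (by simpa using h)
  obtain ⟨c, hc⟩ := Finset.card_pos.1 (by omega : 0 < C.card)
  exact ⟨C, c, hc, hC⟩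

/-- The rank of the Young symmetrizer of a hook on the image of a natural equivariant map of chains
of partitions is stable. -/
theorem exists_hookRank_eq {M : ℕ} (hM : ∀ s ∈ S, s ≤ M) (hM₀ : 1 ≤ M)
    (Φ : ∀ n, SimplicialChains ℂ (RankSelected n S) (m + 1) →ₗ[ℂ]
      SimplicialChains ℂ (RankSelected n S) l)
    (hnat : ∀ n (e : RankSelected n S ↪o RankSelected (n + 1) S) v,
      Φ (n + 1) (Finsupp.mapDomain (fun x => x.trans e) v) =
        Finsupp.mapDomain (fun x => x.trans e) (Φ n v))
    (heq : ∀ n g v, Φ n (partitionChainRep S n (m + 1) g v) =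
      partitionChainRep S n l g (Φ n v)) :
    ∃ a : ℕ, ∀ n, 2 * M + k ≤ n → ∀ C : Finset (Fin n), ∀ c ∈ C, C.card = k + 1 →
      hookRank C c (Φ n) = a := by
  obtain ⟨C₀, c₀, hc₀, hC₀⟩ := exists_hook (by omega : k < 2 * M + k)
  refine ⟨hookRank C₀ c₀ (Φ _), fun n hn => ?_⟩
  induction n, hn using Nat.le_induction with
  | base =>
    intro C c hc hC
    -- Two hooks at the initial size are compared through a common hook one size up.
    obtain ⟨C₁, c₁, hc₁, hC₁⟩ := exists_hook (by omega : k < 2 * M + k + 1)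
    rw [hookRank_succ hM le_rfl hc hC hc₁ hC₁ (hnat _) (heq _),
      hookRank_succ hM le_rfl hc₀ hC₀ hc₁ hC₁ (hnat _) (heq _)]
  | succ n hn ih =>
    intro C c hc hC
    obtain ⟨C₁, c₁, hc₁, hC₁⟩ := exists_hook (by omega : k < n)
    rw [← ih C₁ c₁ hc₁ hC₁, hookRank_succ hM hn hc₁ hC₁ hc hC (hnat _) (heq _)]

end HookRank

theorem boundary_mapDomain (R : Type*) [CommRing R] {P Q : Type*} [PartialOrder P] [PartialOrder Q]
    (m : ℕ) (e : P ↪o Q) (v : SimplicialChains R P (m + 1)) :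
    boundary R Q m (Finsupp.mapDomain (fun x => x.trans e) v) =
      Finsupp.mapDomain (fun x => x.trans e) (boundary R P m v) := by
  induction v using Finsupp.induction_linear with
  | zero => simp
  | add v w hv hw => simp only [map_add, Finsupp.mapDomain_add, hv, hw]
  | single x c =>
    simp only [boundary, Finsupp.mapDomain_single, Finsupp.linearCombination_single,
      Finsupp.mapDomain_smul]
    congr 1
    rw [Finsupp.mapDomain_finsetSum]
    simp only [Finsupp.mapDomain_single]
    rfl

/-! ### The multiplicities of hooks -/

section Multiplicity

variable {n d k : ℕ} {S : Finset ℕ} {μ : YoungDiagram}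

/-- When all ranks of `S` occur, flags are the chains with `|S|` members, equivariantly. -/
theorem multiplicity_specht_alpha (hd : S.card = d + 1) (hS : ∀ s ∈ S, s ≤ n - 1)
    (T : Fin n ≃ μ.cells) :
    multiplicity (specht T) (alpha S n) = Module.finrank ℂ (LinearMap.range
      ((partitionChainRep S n (d + 1)).asAlgebraHom (youngSymmetrizer T))) := by
  rw [← multiplicity_specht]
  let E := chainEquivFlag (P := RankSelected n S) hd rankSelected_strictMono (fun p => p.2)
    fun F s hs => exists_mem_flag F hs (hS s hs)
  symm
  refine multiplicity_congr _ (Finsupp.domLCongr E ≪≫ₗ (MonoidAlgebra.coeffLinearEquiv ℂ).symm)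
    fun g v => ?_
  induction v using Finsupp.induction_linear with
  | zero => simp
  | add v w hv hw => simp only [map_add, hv, hw]
  | single x r =>
    rw [partitionChainRep_single]
    simp only [LinearEquiv.trans_apply, Finsupp.domLCongr_single]
    refine Eq.trans ?_ (Representation.ofMulAction_single (permAut n S g) (E x) r).symm
    rw [← chainEquivFlag_trans]
    rfl

instance {m : ℕ} {P : Type*} [PartialOrder P] [Finite P] : Finite (Fin m ↪o P) :=
  Finite.of_injective (fun x : Fin m ↪o P => (x : Fin m → P)) DFunLike.coe_injective

theorem isEmpty_chain (hd : S.card = d) : IsEmpty (Fin (d + 1) ↪o RankSelected n S) := by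
  refine ⟨fun x => ?_⟩
  have h : Function.Injective fun i => (⟨rank (x i).1, (x i).2⟩ : S) := fun i j hij =>
    (rankSelected_strictMono.comp x.strictMono).injective (congrArg Subtype.val hij)
  have := Fintype.card_le_of_injective _ h
  simp [hd] at this

/-- There are no chains with `|S| + 1` members, so there are no boundaries to divide by and top
homology is the kernel of the boundary map. Nothing about lower homology is needed. -/
theorem multiplicity_specht_homology (hd : S.card = d + 1) (T : Fin n ≃ μ.cells) :
    multiplicity (specht T) ((homologyRep ℂ (RankSelected n S) d).comp (permAut n S)) =
      Module.finrank ℂ (LinearMap.range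
        ((partitionChainRep S n (d + 1)).asAlgebraHom (youngSymmetrizer T))) -
      Module.finrank ℂ (LinearMap.range
        ((partitionChainRep S n d).asAlgebraHom (youngSymmetrizer T) ∘ₗ
          boundary ℂ (RankSelected n S) d)) := by
  have hcomm (g : Equiv.Perm (Fin n)) (v : SimplicialChains ℂ (RankSelected n S) (d + 1)) :
      boundary ℂ (RankSelected n S) d (partitionChainRep S n (d + 1) g v) =
        partitionChainRep S n d g (boundary ℂ (RankSelected n S) d v) :=
    boundary_chainRep ℂ (RankSelected n S) d (permAut n S g) v
  have hker (g : Equiv.Perm (Fin n)) : LinearMap.ker (boundary ℂ (RankSelected n S) d) ≤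
      (LinearMap.ker (boundary ℂ (RankSelected n S) d)).comap (partitionChainRep S n (d + 1) g) :=
    fun v hv => by
      change boundary ℂ (RankSelected n S) d _ = 0
      rw [hcomm, (hv : boundary ℂ (RankSelected n S) d v = 0), map_zero]
  rw [← finrank_range_asAlgebraHom_ker (boundary ℂ (RankSelected n S) d) hcomm hker,
    ← multiplicity_specht]
  have hbot : (LinearMap.range (boundary ℂ (RankSelected n S) (d + 1))).comap
      (LinearMap.ker (boundary ℂ (RankSelected n S) d)).subtype = ⊥ := by
    have := isEmpty_chain (n := n) hd
    rw [Subsingleton.elim (boundary ℂ (RankSelected n S) (d + 1)) 0, LinearMap.range_zero,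
      ← LinearMap.ker, Submodule.ker_subtype]
  symm
  exact multiplicity_congr _ (Submodule.quotEquivOfEqBot _ hbot).symm fun _ _ => rfl

end Multiplicity

end RankStab

end

theorem corollary5p8 (S : Finset ℕ) (hS : S.Nonempty) (hpos : ∀ s ∈ S, 1 ≤ s) (k : ℕ) :
    ∃ a b : ℕ, ∀ n : ℕ, 2 * S.max' hS + k ≤ n →
      ∀ μ : YoungDiagram, μ.rowLens = (n - k) :: List.replicate k 1 →
        ∀ T : Fin n ≃ μ.cells,
          RankStab.multiplicity (RankStab.specht T) (RankStab.alpha S n) = a ∧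
            RankStab.multiplicity (RankStab.specht T) (RankStab.beta S n) = b := by
  have hd : S.card = S.card - 1 + 1 := (Nat.succ_pred_eq_of_pos hS.card_pos).symm
  have hM : ∀ s ∈ S, s ≤ S.max' hS := fun s hs => S.le_max' s hs
  have hM₀ : 1 ≤ S.max' hS := hpos _ (S.max'_mem hS)
  obtain ⟨a, ha⟩ := RankStab.exists_hookRank_eq (k := k) hM hM₀
    (fun n => (LinearMap.id : RankStab.SimplicialChains ℂ (RankStab.RankSelected n S)
      (S.card - 1 + 1) →ₗ[ℂ] _)) (fun _ _ _ => rfl) (fun _ _ _ => rfl)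
  obtain ⟨b, hb⟩ := RankStab.exists_hookRank_eq (k := k) hM hM₀
    (fun n => RankStab.boundary ℂ (RankStab.RankSelected n S) (S.card - 1))
    (fun _ e v => RankStab.boundary_mapDomain ℂ _ e v)
    (fun n g v => RankStab.boundary_chainRep ℂ _ _ (RankStab.permAut n S g) v)
  -- Here `b` is the stable rank of `c ∘ ∂`. It is at most the rank `a` of `c`, as `∂` is
  -- equivariant, so the truncated subtraction loses nothing.
  refine ⟨a, a - b, fun n hn μ hμ T => ?_⟩
  obtain ⟨C, c, hc, hC, hrow, hcol⟩ := RankStab.exists_hook_groups (by omega) hμ T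
  have hy : RankStab.youngSymmetrizer T = RankStab.subgroupSum (RankStab.hookRowGroup C c) *
      RankStab.charSum Equiv.Perm.sign (RankStab.hookColGroup C) := by
    rw [RankStab.hookRowGroup, RankStab.hookColGroup, ← hrow, ← hcol]
    rfl
  have ha' := ha n hn C c hc hC
  have hb' := hb n hn C c hc hC
  rw [RankStab.hookRank, ← hy] at ha' hb'
  rw [LinearMap.comp_id] at ha'
  constructor
  · rw [RankStab.multiplicity_specht_alpha hd (fun s hs => by have := hM s hs; omega), ha']
  · rw [RankStab.beta, RankStab.multiplicity_specht_homology hd, ha', hb']
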